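/- Let $n\ge 1$, $\delta>0$, let $d(x,y)=\|x-y\|$ for some norm on $\mathbb{R}^n$, and let $\mathcal{D}=\{\delta m : m\in\mathbb{Z}^n\}$. The $\delta$-roundoff of $x\in\mathbb{R}^n$ is the point $\tilde x=\delta m$, where $(m_j-\tfrac12)\delta\le x_j<(m_j+\tfrac12)\delta$ for every $j$; the $\delta$-roundoff of a map $w:\mathbb{R}^n\to\mathbb{R}^n$ is the map $\tilde w:\mathcal{D}\to\mathcal{D}$, $\tilde w(x)=\widetilde{w(x)}$. Let $\tilde w_1,\dots,\tilde w_N$ be $\delta$-roundoffs of contractions $w_1,\dots,w_N$ of $(\mathbb{R}^n,d)$ and let $p_1,\dots,p_N:\mathcal{D}\to(0,1]$ satisfy $\sum_i p_i(x)=1$ for every $x\in\mathcal{D}$; that is, $\{\mathcal{D};\tilde w_1,\dots,\tilde w_N;p_1,\dots,p_N\}$ is a discrete iterated function system (DIFS). Let $(X_k)_{k\ge0}$ be the associated Markov chain on $\mathcal{D}$, generated by the random iteration algorithm (RIA): from $X_k=x$, an index $i$ is drawn with probability $p_i(x)$ and $X_{k+1}=\tilde w_i(x)$. Let $\mathcal{A}$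 and $\mathcal{T}$ be the sets of its recurrent and of its transient states. A recurrent class is a closed communication class of recurrent states; it is positive recurrent if all its states have finite expected return time. Then: 1. $\mathcal{A}$ is nonempty and finite, and all its states are positive recurrent. Hence the family of recurrent classes equals the family of positive recurrent classes; it is nonempty, and its union is $\mathcal{A}$. 2. For every nonempty family of positive recurrent classes there is a stationary probability measure of the chain whose support is the union of that family. 3. For every initial state $X_0=x\in\mathcal{D}$, $\Pr(\exists i: X_i\notin\mathcal{T})=1$. 4. For every initial state $X_0=x\in\mathcal{D}$, with probability one there are a positive recurrent class $C$ and a stationary probability measure $\pi$ with support $C$ such that $\{X_i: i\ge m\}=C$ for some $m$, $\frac1M\sum_{i=0}^{M-1}\mathbf 1_{\{y\}}(X_i)\to\pi\{y\}$ for every $y\in\mathcal{D}$, and the empirical measures $\frac1M\sum_{i=0}^{M-1}\delta_{X_i}$ converge weakly to $\pi$ as $M\to\infty$. 5. For every $i$, the intersection $\mathcal{M}[\tilde w_i]$ of all absorbing sets for $\tilde w_i$ is an absorbing set, called the minimal absorbing set; here $\Lambda\subset\mathcal{D}$ is absorbing for $f:\mathcal{D}\to\mathcal{D}$ if for every $x\in\mathcal{D}$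 there is $k$ with $f^{\circ l}(x)\in\Lambda$ for all $l\ge k$. Its components are the equivalence classes of the relation "$f^{\circ a}(x)=f^{\circ b}(y)$ for some $a,b$" (with $f=\tilde w_i$) on $\mathcal{M}[\tilde w_i]$, and the basin of attraction of a component $B$ is $\{x\in\mathcal{D}:\tilde w_i^{\circ l}(x)\in B\text{ for some }l\}$. If $\mathcal{M}[\tilde w_i]$ has exactly one component for some $i$, or if there are $i,j$ such that $\mathcal{M}[\tilde w_i]$ is contained in the basin of attraction of a single component of $\mathcal{M}[\tilde w_j]$, then the chain has exactly one stationary probability measure. -/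

import Mathlib

open MeasureTheory ProbabilityTheory
open scoped ENNReal

namespace DiscreteIFS

/-! ### The discrete space and roundoffs -/

/-- The half-open cube of side `δ` centred at `δ m`. -/
def cube {n : ℕ} (δ : ℝ) (m : Fin n → ℤ) : Set (Fin n → ℝ) :=
  {x | ∀ j, ((m j : ℝ) - 1 / 2) * δ ≤ x j ∧ x j < ((m j : ℝ) + 1 / 2) * δ}

/-- The `δ`-discretization of `ℝⁿ`: the set of the centres of all the cubes. -/
def grid (n : ℕ) (δ : ℝ) : Set (Fin n → ℝ) :=
  {x | ∃ m : Fin n → ℤ, x = fun j => δ * (m j : ℝ)}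

instance instCountableGrid (n : ℕ) (δ : ℝ) : Countable (grid n δ) := by
  have h : grid n δ = Set.range (fun (m : Fin n → ℤ) (j : Fin n) => δ * (m j : ℝ)) := by
    ext x
    constructor
    · rintro ⟨m, rfl⟩
      exact ⟨m, rfl⟩
    · rintro ⟨m, rfl⟩
      exact ⟨m, rfl⟩
  rw [h]
  exact (Set.countable_range _).to_subtype

/-- The integer index of the cube that contains `x` (see `mem_cube_iff`). -/
noncomputable def cubeIndex {n : ℕ} (δ : ℝ) (x : Fin n → ℝ) : Fin n → ℤ :=
  fun j => ⌊x j / δ + 1 / 2⌋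

theorem mem_cube_iff {n : ℕ} {δ : ℝ} (hδ : 0 < δ) (x : Fin n → ℝ) (m : Fin n → ℤ) :
    x ∈ cube δ m ↔ m = cubeIndex δ x := by
  have key : ∀ j, (((m j : ℝ) - 1 / 2) * δ ≤ x j ∧ x j < ((m j : ℝ) + 1 / 2) * δ) ↔
      m j = ⌊x j / δ + 1 / 2⌋ := by
    intro j
    rw [eq_comm, Int.floor_eq_iff, ← le_div_iff₀ hδ, ← div_lt_iff₀ hδ]
    constructor
    · rintro ⟨h1, h2⟩
      constructor <;> linarith
    · rintro ⟨h1, h2⟩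
      constructor <;> linarith
  rw [funext_iff]
  exact forall_congr' key

/-- The `δ`-roundoff of a point: the centre of the cube that contains it. -/
noncomputable def roundoff {n : ℕ} (δ : ℝ) (x : Fin n → ℝ) : grid n δ :=
  ⟨fun j => δ * (cubeIndex δ x j : ℝ), cubeIndex δ x, rfl⟩

/-- The `δ`-roundoff of a mapping of `ℝⁿ`. -/
noncomputable def roundoffMap {n : ℕ} (δ : ℝ) (w : (Fin n → ℝ) → (Fin n → ℝ)) :
    grid n δ → grid n δ :=
  fun x => roundoff δ (w x)

/-- `w` is a contraction for the metric `d(x, y) = ‖x - y‖` of the given (semi)norm. -/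
def IsContraction {n : ℕ} (nrm : Seminorm ℝ (Fin n → ℝ)) (w : (Fin n → ℝ) → (Fin n → ℝ)) : Prop :=
  ∃ c : ℝ, 0 ≤ c ∧ c < 1 ∧ ∀ x y, nrm (w x - w y) ≤ c * nrm (x - y)

/-! ### Absorbing sets -/

section Absorbing

variable {S : Type*}

/-- `L` is an absorbing set for `f` in `C`. -/
def IsAbsorbing (f : S → S) (C L : Set S) : Prop :=
  L ⊆ C ∧ ∀ x ∈ C, ∃ k : ℕ, ∀ i ≥ k, f^[i] x ∈ L

/-- The intersection of all the absorbing sets for `f` in `C`; when it is itself absorbing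
in `C`, it is the minimal absorbing set for `f` in `C`. -/
def minAbsorbing (f : S → S) (C : Set S) : Set S :=
  ⋂₀ {L | IsAbsorbing f C L}

/-- The orbits of `x` and `y` meet. -/
def OrbitsMeet (f : S → S) (x y : S) : Prop :=
  ∃ j k : ℕ, f^[j] x = f^[k] y

/-- The components of the minimal absorbing set: its classes for the relation `OrbitsMeet`. -/
def components (f : S → S) (C : Set S) : Set (Set S) :=
  {B | ∃ x ∈ minAbsorbing f C, B = {y ∈ minAbsorbing f C | OrbitsMeet f x y}}

/-- The basin of attraction, in `C`, of a component `B`. -/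
def basin (f : S → S) (C B : Set S) : Set S :=
  {x ∈ C | ∃ i : ℕ, f^[i] x ∈ B}

end Absorbing

/-! ### Countable Markov chains -/

section Markov

variable {S : Type*} [Countable S] [MeasurableSpace S] [MeasurableSingletonClass S]

/-- The law, on the space of orbits `ℕ → S`, of the time-homogeneous Markov chain with
transition kernel `κ` that starts at `x`. -/
noncomputable def chainLaw (κ : Kernel S S) [IsMarkovKernel κ] (x : S) : Measure (ℕ → S) :=
  Kernel.traj (X := fun _ : ℕ => S)
    (fun k : ℕ => κ.comap (fun h : (i : Finset.Iic k) → S => h ⟨k, Finset.mem_Iic.2 le_rfl⟩)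
      (measurable_pi_apply _)) 0 (fun _ => x)

variable (κ : Kernel S S) [IsMarkovKernel κ]

/-- `y` is reached from `x` with positive probability in a finite number of steps. -/
def Accessible (x y : S) : Prop :=
  ∃ k : ℕ, 0 < chainLaw κ x {X | X k = y}

def Communicate (x y : S) : Prop :=
  Accessible κ x y ∧ Accessible κ y x

/-- A maximal set of states any two of which communicate. -/
def IsCommunicationClass (C : Set S) : Prop :=
  Maximal (fun B : Set S => ∀ x ∈ B, ∀ y ∈ B, Communicate κ x y) C

/-- Only states of `C` are accessible from states of `C`. -/
def IsClosedClass (C : Set S) : Prop :=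
  ∀ x ∈ C, ∀ y, Accessible κ x y → y ∈ C

/-- With probability one, the chain that starts at `x` returns to `x`. -/
def IsRecurrent (x : S) : Prop :=
  chainLaw κ x {X | ∃ k : ℕ, 1 ≤ k ∧ X k = x} = 1

/-- The number of steps to the first return to `x` (`⊤` if there is no return). -/
noncomputable def returnTime (x : S) (X : ℕ → S) : ℝ≥0∞ :=
  ⨅ (k : ℕ) (_ : 1 ≤ k ∧ X k = x), (k : ℝ≥0∞)

/-- A recurrent state whose expected return time is finite. -/
def IsPositiveRecurrent (x : S) : Prop :=
  IsRecurrent κ x ∧ ∫⁻ X, returnTime x X ∂(chainLaw κ x) < ⊤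

def recurrentStates : Set S := {x | IsRecurrent κ x}

def transientStates : Set S := {x | ¬ IsRecurrent κ x}

/-- The family of the recurrent communication classes. -/
def recurrentClasses : Set (Set S) :=
  {C | IsCommunicationClass κ C ∧ IsClosedClass κ C ∧ ∀ x ∈ C, IsRecurrent κ x}

/-- The family of the positive recurrent communication classes. -/
def positiveRecurrentClasses : Set (Set S) :=
  {C | IsCommunicationClass κ C ∧ IsClosedClass κ C ∧ ∀ x ∈ C, IsPositiveRecurrent κ x}

/-- `π` is a stationary probability measure of the chain. -/
def IsStationary (π : Measure S) : Prop :=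
  IsProbabilityMeasure π ∧ Kernel.Invariant κ π

/-- The support of a measure on a countable discrete space. -/
def atoms (π : Measure S) : Set S := {x | 0 < π {x}}

/-- The orbit `X` renders the measure `π`: the empirical measures `(1/M) ∑_{i < M} δ_{X i}`
converge to `π` at each point and weakly (every function on the discrete space `S` is
continuous). -/
def Renders (X : ℕ → S) (π : Measure S) : Prop :=
  (∀ y : S, Filter.Tendsto
    (fun M : ℕ => (1 / (M : ℝ)) * ∑ i ∈ Finset.range M, Set.indicator {y} (fun _ => (1 : ℝ)) (X i))
    Filter.atTop (nhds (π.real {y}))) ∧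
  (∀ f : S → ℝ, (∃ B : ℝ, ∀ y, |f y| ≤ B) → Filter.Tendsto
    (fun M : ℕ => (1 / (M : ℝ)) * ∑ i ∈ Finset.range M, f (X i))
    Filter.atTop (nhds (∫ y, f y ∂π)))

end Markov

/-! ### Discrete iterated function systems -/

/-- `N` self-maps of `S` with place-dependent positive probability weights. -/
structure DIFS (S : Type*) (N : ℕ) where
  map : Fin N → S → S
  prob : Fin N → S → ℝ
  prob_mem : ∀ i x, prob i x ∈ Set.Ioc (0 : ℝ) 1
  sum_prob : ∀ x, ∑ i, prob i x = 1

section Step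

variable {S : Type*} [Countable S] [MeasurableSpace S] [MeasurableSingletonClass S] {N : ℕ}

/-- One step of the random iteration algorithm: from `x`, draw the index `i` with probability
`prob i x` and move to `map i x`. -/
noncomputable def DIFS.step (F : DIFS S N) : Kernel S S where
  toFun x := ∑ i, ENNReal.ofReal (F.prob i x) • Measure.dirac (F.map i x)
  measurable' := Measurable.of_discrete

instance DIFS.instIsMarkovKernelStep (F : DIFS S N) : IsMarkovKernel F.step := by
  refine ⟨fun x => ⟨?_⟩⟩
  change (∑ i, ENNReal.ofReal (F.prob i x) • Measure.dirac (F.map i x)) Set.univ = 1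
  rw [Measure.finsetSum_apply]
  simp only [Measure.smul_apply, measure_univ, smul_eq_mul, mul_one]
  rw [← ENNReal.ofReal_sum_of_nonneg (fun i _ => (F.prob_mem i x).1.le), F.sum_prob x,
    ENNReal.ofReal_one]

end Step

end DiscreteIFS

/-! Rounding displaces a point by a bounded amount, so each map satisfies ‖w̃ᵢ x‖ ≤ c ‖x‖ + D with c
< 1. Outside a large ball the norm drops by more than 1 per step, and a ball holds finitely many
grid points. Hence a finite set `K`, invariant under all the maps, catches every orbit whatever
indices are drawn (`DIFS.Attracts`, `exists_attracts`). The Markov chain results need nothing else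
about contractions.

All weights being positive, accessibility is reachability in the graph of the maps. The recurrent
states are exactly the essential ones, and the forward set of an essential state is a finite closed
class. The probability rests on linear equations for the averaging operator P on finite sets,
solvable because a minimum principle makes them injective: g - Pg = f on a set that can be left,
with g = 0 outside (Dirichlet), and f - a = g - Pg on a class (Poisson). The differences g(X_{k+1})
- Pg(X_k) are bounded martingale increments, and a fourth-moment bound makes their sum o(n) almost
surely. So the averages of f along an orbit tend to a as soon as f - a = g - Pg on its tail
(`DIFS.tendsto_average`). Suitable choices of f give absorption into essential states, the filling
of a class and the convergence of empirical measures, a being the integral of f against the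
stationary measure of the class. A Dirichlet solution also bounds the expected return time.

Under the uniqueness hypotheses any two orbits can be steered to a common point. One class is then
reachable from everywhere, so it carries every stationary measure, and integrating the Poisson
equation identifies that measure. -/

namespace DiscreteIFS

/-! ### Harmonic analysis of a discrete IFS on finite sets -/

section Graph

variable {S : Type*} {N : ℕ}

/-- The averaging operator of a discrete IFS. -/
noncomputable def DIFS.avg (F : DIFS S N) : (S → ℝ) →ₗ[ℝ] (S → ℝ) where
  toFun g x := ∑ i, F.prob i x * g (F.map i x)
  map_add' g h := by
    ext x
    simp [mul_add, Finset.sum_add_distrib]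
  map_smul' c g := by
    ext x
    simp only [Pi.smul_apply, smul_eq_mul, RingHom.id_apply, Finset.mul_sum]
    exact Finset.sum_congr rfl fun i _ => by ring

/-- `y` is the image of `x` under one of the maps. -/
def DIFS.Edge (F : DIFS S N) (x y : S) : Prop := ∃ i, F.map i x = y

/-- `y` is the image of `x` under a finite composition of the maps. -/
abbrev DIFS.Reach (F : DIFS S N) : S → S → Prop := Relation.ReflTransGen F.Edge

/-- A nonempty finite set that is invariant under the maps and strongly connected. -/
structure DIFS.IsFiniteClass (F : DIFS S N) (C : Set S) : Prop where
  nonempty : C.Nonempty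
  finite : C.Finite
  map_mem : ∀ x ∈ C, ∀ i, F.map i x ∈ C
  reach : ∀ x ∈ C, ∀ y ∈ C, F.Reach x y

/-- Every state that can be reached from `x` leads back to `x`. -/
def DIFS.Essential (F : DIFS S N) (x : S) : Prop := ∀ y, F.Reach x y → F.Reach y x

/-- `K` is a finite set, invariant under the maps, which every orbit enters. -/
structure DIFS.Attracts (F : DIFS S N) (K : Set S) : Prop where
  finite : K.Finite
  map_mem : ∀ x ∈ K, ∀ i, F.map i x ∈ K
  exists_mem : ∀ X : ℕ → S, (∀ k, F.Edge (X k) (X (k + 1))) → ∃ k, X k ∈ K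

variable (F : DIFS S N)

theorem DIFS.avg_apply (g : S → ℝ) (x : S) :
    F.avg g x = ∑ i, F.prob i x * g (F.map i x) := rfl

theorem DIFS.avg_eq_of_forall_eq {g : S → ℝ} {x : S} {m : ℝ} (h : ∀ i, g (F.map i x) = m) :
    F.avg g x = m := by
  simp [DIFS.avg_apply, h, ← Finset.sum_mul, F.sum_prob]

theorem DIFS.le_avg {g : S → ℝ} {x : S} {m : ℝ} (h : ∀ i, m ≤ g (F.map i x)) :
    m ≤ F.avg g x := by
  calc m = ∑ i, F.prob i x * m := by rw [← Finset.sum_mul, F.sum_prob, one_mul]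
    _ ≤ _ := Finset.sum_le_sum fun i _ => mul_le_mul_of_nonneg_left (h i) (F.prob_mem i x).1.le

/-- Strict positivity of the weights enters here: a mean that attains a lower bound of its terms
forces every term to attain it. All minimum principles and support arguments below reduce to this.
-/
theorem DIFS.eq_of_avg_le {g : S → ℝ} {x : S} {m : ℝ} (h : ∀ i, m ≤ g (F.map i x))
    (h' : F.avg g x ≤ m) (i : Fin N) : g (F.map i x) = m := by
  have h0 : ∑ i, F.prob i x * (g (F.map i x) - m) = 0 := by
    have h1 : ∑ i, F.prob i x * (g (F.map i x) - m) = F.avg g x - m := by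
      simp [mul_sub, Finset.sum_sub_distrib, ← Finset.sum_mul, F.sum_prob, DIFS.avg_apply]
    rw [h1, sub_eq_zero]
    exact le_antisymm h' (F.le_avg h)
  rw [Finset.sum_eq_zero_iff_of_nonneg fun i _ =>
    mul_nonneg (F.prob_mem i x).1.le (sub_nonneg.2 (h i))] at h0
  have := (mul_eq_zero.1 (h0 i (Finset.mem_univ i))).resolve_left (F.prob_mem i x).1.ne'
  linarith

theorem DIFS.abs_avg_le {g : S → ℝ} {B : ℝ} (hB : ∀ x, |g x| ≤ B) (x : S) : |F.avg g x| ≤ B := by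
  rw [abs_le]
  constructor
  · exact F.le_avg fun i => (abs_le.1 (hB _)).1
  · have := F.le_avg (g := -g) (x := x) (m := -B) fun i => by
      have := (abs_le.1 (hB (F.map i x))).2
      simpa using this
    rw [map_neg] at this
    simpa using this

theorem DIFS.mem_of_reach {C : Set S} (hC : ∀ x ∈ C, ∀ i, F.map i x ∈ C) {x y : S} (hx : x ∈ C)
    (h : F.Reach x y) : y ∈ C := by
  induction h with
  | refl => exact hx
  | tail _ h ih =>
    obtain ⟨i, rfl⟩ := h
    exact hC _ ih i

theorem exists_abs_le_of_finite {T : Set S} (hT : T.Finite) {g : S → ℝ}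
    (hg : ∀ x ∉ T, g x = 0) : ∃ B, 0 ≤ B ∧ ∀ x, |g x| ≤ B := by
  refine ⟨∑ y ∈ hT.toFinset, |g y|, Finset.sum_nonneg fun _ _ => abs_nonneg _, fun x => ?_⟩
  by_cases hx : x ∈ T
  · exact Finset.single_le_sum (f := fun y => |g y|) (fun _ _ => abs_nonneg _)
      (hT.mem_toFinset.2 hx)
  · rw [hg x hx, abs_zero]
    exact Finset.sum_nonneg fun _ _ => abs_nonneg _

/-- On functions supported by a finite set, an injective linear problem is solvable. -/
theorem exists_solution_of_injective {T : Set S} (hT : T.Finite) (L : (S → ℝ) →ₗ[ℝ] (S → ℝ))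
    (hL : ∀ g : S → ℝ, (∀ x ∉ T, g x = 0) → (∀ x ∈ T, L g x = 0) → g = 0) (f : S → ℝ) :
    ∃ g : S → ℝ, (∀ x ∉ T, g x = 0) ∧ ∀ x ∈ T, L g x = f x := by
  classical
  have := hT.to_subtype
  let e : (T → ℝ) →ₗ[ℝ] (S → ℝ) := Function.ExtendByZero.linearMap ℝ (Subtype.val : T → S)
  let r : (S → ℝ) →ₗ[ℝ] (T → ℝ) := LinearMap.funLeft ℝ ℝ (Subtype.val : T → S)
  have he0 : ∀ (h : T → ℝ), ∀ x ∉ T, e h x = 0 := fun h x hx =>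
    Function.extend_apply' _ _ _ (by rintro ⟨a, rfl⟩; exact hx a.2)
  have he1 : ∀ (h : T → ℝ) (x : T), e h x = h x := fun h x =>
    Subtype.val_injective.extend_apply _ _ x
  have hinj : Function.Injective (r ∘ₗ L ∘ₗ e) := by
    rw [injective_iff_map_eq_zero]
    intro h hh
    have h0 := hL (e h) (he0 h) fun x hx => congrFun hh ⟨x, hx⟩
    ext x
    rw [← he1 h x, h0]
    rfl
  obtain ⟨h, hh⟩ := (LinearMap.injective_iff_surjective.1 hinj) (r f)
  exact ⟨e h, he0 h, fun x hx => congrFun hh ⟨x, hx⟩⟩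

/-- A negative minimum would propagate along edges, never leaving `T` since `g` vanishes outside;
but from every point of `T` one can leave it. -/
theorem DIFS.nonneg_of_harmonic {T : Set S} (hT : T.Finite)
    (hr : ∀ x ∈ T, ∃ y ∉ T, F.Reach x y) {g : S → ℝ} (hg : ∀ x ∉ T, g x = 0)
    (hh : ∀ x ∈ T, F.avg g x = g x) (z : S) : 0 ≤ g z := by
  by_contra! hz
  have hzT : z ∈ T := by
    by_contra h
    exact hz.ne (hg z h)
  obtain ⟨x, hx, hmin⟩ := Set.exists_min_image T g hT ⟨z, hzT⟩
  have hx0 : g x < 0 := (hmin z hzT).trans_lt hz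
  have hall : ∀ y, g x ≤ g y := fun y => by
    by_cases hy : y ∈ T
    · exact hmin y hy
    · rw [hg y hy]
      exact hx0.le
  obtain ⟨y, hy, hxy⟩ := hr x hx
  have : ∀ y, F.Reach x y → g y = g x := by
    intro y hxy
    induction hxy with
    | refl => rfl
    | @tail b c _ hbc ih =>
      obtain ⟨i, rfl⟩ := hbc
      have hb : b ∈ T := by
        by_contra h
        rw [hg b h] at ih
        exact hx0.ne ih.symm
      exact F.eq_of_avg_le (fun i => hall _) ((hh b hb).trans ih).le i
  have h1 := this y hxy
  rw [hg y hy] at h1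
  exact hx0.ne h1.symm

/-- Solvability of the Dirichlet problem on a finite set from which one can escape. -/
theorem DIFS.exists_dirichlet {T : Set S} (hT : T.Finite)
    (hr : ∀ x ∈ T, ∃ y ∉ T, F.Reach x y) (f : S → ℝ) :
    ∃ g : S → ℝ, (∀ x ∉ T, g x = 0) ∧ ∀ x ∈ T, g x - F.avg g x = f x := by
  refine exists_solution_of_injective hT (LinearMap.id - F.avg) (fun g h0 hL => ?_) f
  have hh : ∀ x ∈ T, F.avg g x = g x := fun x hx => (sub_eq_zero.1 (hL x hx)).symm
  ext z
  refine le_antisymm ?_ (F.nonneg_of_harmonic hT hr h0 hh z)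
  have := F.nonneg_of_harmonic hT hr (g := -g) (fun x hx => by simp [h0 x hx])
    (fun x hx => by rw [map_neg]; simp [hh x hx]) z
  simpa using this

/-! ### The Poisson equation on a finite closed class. -/

variable {F} {C : Set S}

/-- The minimum over `C` propagates along edges, and strong connectedness carries it to all of `C`.
-/
theorem DIFS.IsFiniteClass.eq_of_superharmonic (hC : F.IsFiniteClass C) {g : S → ℝ}
    (hg : ∀ x ∈ C, F.avg g x ≤ g x) : ∀ x ∈ C, ∀ y ∈ C, g x = g y := by
  obtain ⟨z, hz, hmin⟩ := Set.exists_min_image C g hC.finite hC.nonempty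
  have : ∀ y, F.Reach z y → y ∈ C ∧ g y = g z := by
    intro y h
    induction h with
    | refl => exact ⟨hz, rfl⟩
    | @tail b c _ hbc ih =>
      obtain ⟨i, rfl⟩ := hbc
      exact ⟨hC.map_mem _ ih.1 i, F.eq_of_avg_le (fun i => hmin _ (hC.map_mem _ ih.1 i))
        ((hg b ih.1).trans ih.2.le) i⟩
  intro x hx y hy
  rw [(this x (hC.reach z hz x hx)).2, (this y (hC.reach z hz y hy)).2]

theorem DIFS.IsFiniteClass.eq_mean (hC : F.IsFiniteClass C) {f g : S → ℝ} {a : ℝ}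
    (hf : ∀ x ∈ C, a ≤ f x) (h : ∀ x ∈ C, f x - a = g x - F.avg g x) : ∀ x ∈ C, f x = a := by
  have hc := hC.eq_of_superharmonic (g := g) fun x hx => by
    have := h x hx
    have := hf x hx
    linarith
  intro x hx
  have h1 := h x hx
  rw [F.avg_eq_of_forall_eq fun i => hc _ (hC.map_mem x hx i) x hx] at h1
  linarith

theorem DIFS.IsFiniteClass.mean_eq_zero (hC : F.IsFiniteClass C) {g : S → ℝ} {a : ℝ}
    (h : ∀ x ∈ C, a = g x - F.avg g x) : a = 0 := by
  obtain ⟨x, hx⟩ := hC.nonempty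
  rcases le_total a 0 with ha | ha
  · exact (hC.eq_mean (f := 0) (g := -g) (a := a) (fun _ _ => ha) (fun x hx => by
      rw [map_neg]; have := h x hx; simp; linarith) x hx).symm
  · have := hC.eq_mean (f := 0) (g := g) (a := -a) (fun _ _ => by simpa using ha) (fun x hx => by
      have := h x hx; simp; linarith) x hx
    simp at this
    exact this

/-- Solvability of the Poisson equation on a finite class. -/
theorem DIFS.IsFiniteClass.exists_poisson (hC : F.IsFiniteClass C) (f : S → ℝ) :
    ∃ (a : ℝ) (g : S → ℝ), (∀ x ∉ C, g x = 0) ∧ ∀ x ∈ C, f x - a = g x - F.avg g x := by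
  obtain ⟨y, hy⟩ := hC.nonempty
  -- The unknown constant `a` is normalised to be `g y`, which makes the problem square. A kernel
  -- element has `g - avg g` constant on `C`, so `g y = 0`; it is then harmonic, hence constant on
  -- `C`, hence zero.
  let L : (S → ℝ) →ₗ[ℝ] (S → ℝ) :=
    LinearMap.id - F.avg + LinearMap.pi fun _ => LinearMap.proj y
  have hinj : ∀ g : S → ℝ, (∀ x ∉ C, g x = 0) → (∀ x ∈ C, L g x = 0) → g = 0 := by
    intro g h0 hL
    have hL' : ∀ x ∈ C, g x - F.avg g x + g y = 0 := fun x hx => by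
      simpa [L] using hL x hx
    have hy0 : -g y = 0 := hC.mean_eq_zero (g := g) fun x hx => by linarith [hL' x hx]
    have hc := hC.eq_of_superharmonic (g := g) fun x hx => by linarith [hL' x hx]
    ext x
    by_cases hx : x ∈ C
    · rw [hc x hx y hy, Pi.zero_apply]
      linarith
    · exact h0 x hx
  obtain ⟨g, h0, hg⟩ := exists_solution_of_injective hC.finite L hinj f
  refine ⟨g y, g, h0, fun x hx => ?_⟩
  rw [← hg x hx]
  simp [L]

/-- A finite class carries strictly positive weights whose average solves the Poisson equation. -/
theorem DIFS.IsFiniteClass.exists_weights (hC : F.IsFiniteClass C) :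
    ∃ p : S → ℝ, (∀ x ∈ C, 0 < p x) ∧ (∀ x ∉ C, p x = 0) ∧ ∀ f : S → ℝ,
      ∃ g : S → ℝ, (∀ x ∉ C, g x = 0) ∧
        ∀ x ∈ C, f x - ∑ y ∈ hC.finite.toFinset, p y * f y = g x - F.avg g x := by
  classical
  -- The weight of `y` is the Poisson constant of the indicator of `y`; linearity then handles every
  -- `f`.
  choose a G hG0 hG using fun y : S => hC.exists_poisson (Pi.single y 1)
  have ha : ∀ y ∈ C, 0 < a y := by
    intro y hy
    by_contra! h
    -- If `a y ≤ 0`, the indicator of `y` is at least `a y`, so it equals `a y` on `C`; at `y` this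
    -- reads `1 = a y`.
    have h1 := hC.eq_mean (fun x _ => h.trans (by
      by_cases hxy : x = y
      · subst hxy; simp
      · simp [hxy])) (hG y) y hy
    simp at h1
    linarith
  refine ⟨fun y => if y ∈ C then a y else 0, fun x hx => by simp [hx, ha x hx],
    fun x hx => by simp [hx], fun f => ⟨∑ y ∈ hC.finite.toFinset, f y • G y, fun x hx => ?_,
      fun x hx => ?_⟩⟩
  · simp [Finset.sum_apply, hG0 _ x hx]
  · have h1 : f x = ∑ y ∈ hC.finite.toFinset, f y * (Pi.single y (1 : ℝ) : S → ℝ) x := by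
      rw [Finset.sum_eq_single x]
      · simp
      · intro b _ hb
        simp [hb.symm]
      · simp [hx]
    rw [map_sum, Finset.sum_apply, Finset.sum_apply]
    conv_lhs => rw [h1]
    rw [← Finset.sum_sub_distrib, ← Finset.sum_sub_distrib]
    refine Finset.sum_congr rfl fun y hy => ?_
    simp only [if_pos (hC.finite.mem_toFinset.1 hy)]
    rw [map_smul, Pi.smul_apply, Pi.smul_apply,
      smul_eq_mul, smul_eq_mul, ← mul_sub, ← hG y x hx]
    ring

/-- The Poisson constant is unique: subtracting two solutions makes a constant of the form `g - avg
g`, which is zero. -/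
theorem DIFS.IsFiniteClass.sum_eq_mean (hC : F.IsFiniteClass C) {p : S → ℝ}
    (hp : ∀ f : S → ℝ, ∃ g : S → ℝ, (∀ x ∉ C, g x = 0) ∧
      ∀ x ∈ C, f x - ∑ y ∈ hC.finite.toFinset, p y * f y = g x - F.avg g x)
    {f g : S → ℝ} {a : ℝ} (h : ∀ x ∈ C, f x - a = g x - F.avg g x) :
    ∑ y ∈ hC.finite.toFinset, p y * f y = a := by
  obtain ⟨g', -, hg'⟩ := hp f
  have := hC.mean_eq_zero (g := g - g') (a := ∑ y ∈ hC.finite.toFinset, p y * f y - a)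
    fun x hx => by
      have h1 := h x hx
      have h2 := hg' x hx
      rw [map_sub]
      simp only [Pi.sub_apply]
      linarith
  linarith

/-! ### Essential states and their forward sets. -/

theorem DIFS.Essential.isFiniteClass {K : Set S} (hK : F.Attracts K) {x : S} (hx : x ∈ K)
    (h : F.Essential x) : F.IsFiniteClass {y | F.Reach x y} where
  nonempty := ⟨x, .refl⟩
  finite := hK.finite.subset fun _ hy => F.mem_of_reach hK.map_mem hx hy
  map_mem _ hy i := hy.tail ⟨i, rfl⟩
  reach _ hy _ hz := (h _ hy).trans hz

theorem DIFS.exists_orbit [Nonempty (Fin N)] (x : S) :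
    ∃ X : ℕ → S, X 0 = x ∧ ∀ k, F.Edge (X k) (X (k + 1)) :=
  ⟨fun k => (F.map (Classical.arbitrary _))^[k] x, rfl, fun _ =>
    ⟨Classical.arbitrary _, (Function.iterate_succ_apply' _ _ _).symm⟩⟩

theorem DIFS.nonempty_index (F : DIFS S N) (x : S) : Nonempty (Fin N) := by
  by_contra h
  rw [not_nonempty_iff] at h
  have := F.sum_prob x
  simp at this

theorem DIFS.reach_of_orbit {X : ℕ → S} (hX : ∀ k, F.Edge (X k) (X (k + 1))) {a b : ℕ}
    (hab : a ≤ b) : F.Reach (X a) (X b) := by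
  induction b, hab using Nat.le_induction with
  | base => exact .refl
  | succ b _ ih => exact ih.tail (hX b)

theorem DIFS.Attracts.exists_reach {K : Set S} (hK : F.Attracts K) (x : S) :
    ∃ y ∈ K, F.Reach x y := by
  have := F.nonempty_index x
  obtain ⟨X, rfl, hX⟩ := F.exists_orbit x
  obtain ⟨k, hk⟩ := hK.exists_mem X hX
  exact ⟨_, hk, F.reach_of_orbit hX (Nat.zero_le k)⟩

theorem DIFS.Essential.mem {K : Set S} (hK : F.Attracts K) {x : S} (h : F.Essential x) :
    x ∈ K := by
  obtain ⟨y, hy, hxy⟩ := hK.exists_reach x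
  exact F.mem_of_reach hK.map_mem hy (h y hxy)

/-- Among the states reachable from a point of `K`, one with the smallest forward set is essential:
any successor has a forward set contained in it and no smaller, hence equal to it. -/
theorem DIFS.Attracts.exists_essential {K : Set S} (hK : F.Attracts K) (x : S) :
    ∃ y, F.Reach x y ∧ F.Essential y := by
  obtain ⟨z, hz, hxz⟩ := hK.exists_reach x
  have hfin : ({y | F.Reach z y} : Set S).Finite :=
    hK.finite.subset fun _ hy => F.mem_of_reach hK.map_mem hz hy
  obtain ⟨y, hy, hmin⟩ := Set.exists_min_image {y | F.Reach z y}
    (fun y => ({u | F.Reach y u} : Set S).ncard) hfin ⟨z, .refl⟩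
  refine ⟨y, hxz.trans hy, fun u hu => ?_⟩
  have hsub : ({v | F.Reach u v} : Set S) ⊆ {v | F.Reach y v} := fun v hv => hu.trans hv
  have hyfin : ({v | F.Reach y v} : Set S).Finite := hfin.subset fun v hv => hy.trans hv
  have heq := Set.eq_of_subset_of_ncard_le hsub (hmin u (hy.trans hu)) hyfin
  have : y ∈ ({v | F.Reach u v} : Set S) := by
    rw [heq]
    exact Relation.ReflTransGen.refl
  exact this

theorem DIFS.Essential.of_mem_class (hC : F.IsFiniteClass C) {x : S} (hx : x ∈ C) :
    F.Essential x := fun _ hy => hC.reach _ (F.mem_of_reach hC.map_mem hx hy) _ hx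

end Graph

/-! ### The Markov property and the law of large numbers for martingale increments -/

section Chain

variable {S : Type*} [Countable S] [MeasurableSpace S] [MeasurableSingletonClass S] {N : ℕ}

instance instIsProbabilityMeasureChainLaw (κ : Kernel S S) [IsMarkovKernel κ] (x : S) :
    IsProbabilityMeasure (chainLaw κ x) := by
  unfold chainLaw
  infer_instance

omit [Countable S] [MeasurableSpace S] [MeasurableSingletonClass S] in
theorem exists_eq_comp_frestrictLe {n : ℕ} {E : Type*} {Φ : (ℕ → S) → E}
    (hΦ : DependsOn Φ (Set.Iic n)) :
    ∃ φ : (Finset.Iic n → S) → E,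
      Φ = φ ∘ (Preorder.frestrictLe (π := fun _ : ℕ => S) n) := by
  classical
  -- A history up to `n` is extended by repeating its last state; `Φ` does not see the extension.
  refine ⟨fun h => Φ fun k => h ⟨min k n, Finset.mem_Iic.2 (min_le_right _ _)⟩, ?_⟩
  ext X
  refine hΦ fun i hi => ?_
  have : min i n = i := min_eq_left hi
  simp [Preorder.frestrictLe, this]

/-- Finite histories form a countable discrete space, so every function of them is measurable. -/
theorem measurable_of_dependsOn {n : ℕ} {E : Type*} [MeasurableSpace E] {Φ : (ℕ → S) → E}
    (hΦ : DependsOn Φ (Set.Iic n)) : Measurable Φ := by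
  obtain ⟨φ, rfl⟩ := exists_eq_comp_frestrictLe hΦ
  exact (Measurable.of_discrete (f := φ)).comp (Preorder.measurable_frestrictLe n)

theorem integrable_of_dependsOn {n : ℕ} {Φ : (ℕ → S) → ℝ} (hΦ : DependsOn Φ (Set.Iic n)) {B : ℝ}
    (hB : ∀ X, |Φ X| ≤ B) (μ : Measure (ℕ → S)) [IsFiniteMeasure μ] : Integrable Φ μ :=
  .of_bound (measurable_of_dependsOn hΦ).aestronglyMeasurable B (.of_forall hB)

theorem DIFS.integral_step (F : DIFS S N) (g : S → ℝ) (x : S) :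
    ∫ y, g y ∂F.step x = F.avg g x := by
  change ∫ y, g y ∂(∑ i, ENNReal.ofReal (F.prob i x) • Measure.dirac (F.map i x)) = _
  rw [integral_finsetSum_measure]
  · refine Finset.sum_congr rfl fun i _ => ?_
    rw [integral_smul_measure, integral_dirac, ENNReal.toReal_ofReal (F.prob_mem i x).1.le,
      smul_eq_mul]
  · intro i _
    refine Integrable.smul_measure ?_ ENNReal.ofReal_ne_top
    exact integrable_dirac (by simp)

theorem chainLaw_zero (κ : Kernel S S) [IsMarkovKernel κ] (x : S) :
    ∀ᵐ X ∂chainLaw κ x, X 0 = x := by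
  have h := Kernel.traj_map_frestrictLe_apply (X := fun _ : ℕ => S)
    (κ := fun k : ℕ => κ.comap (fun h : (i : Finset.Iic k) → S => h ⟨k, Finset.mem_Iic.2 le_rfl⟩)
      (measurable_pi_apply _)) 0 0 (fun _ => x)
  rw [Kernel.partialTraj_self, Kernel.id_apply] at h
  have h1 : ∀ᵐ Y ∂(Measure.dirac (fun _ : Finset.Iic 0 => x)),
      Y ⟨0, Finset.mem_Iic.2 le_rfl⟩ = x := by
    rw [ae_dirac_iff (MeasurableSet.of_discrete)]
  rw [← h] at h1
  exact ae_of_ae_map (Preorder.measurable_frestrictLe 0).aemeasurable h1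

variable (F : DIFS S N) (x : S)

/-- The Markov property. -/
theorem DIFS.integral_mul_next {n : ℕ} {Φ : (ℕ → S) → ℝ} (hΦ : DependsOn Φ (Set.Iic n))
    {B : ℝ} (hB : ∀ X, |Φ X| ≤ B) {g : S → ℝ} {B' : ℝ} (hB' : ∀ y, |g y| ≤ B') :
    ∫ X, Φ X * g (X (n + 1)) ∂chainLaw F.step x =
      ∫ X, Φ X * F.avg g (X n) ∂chainLaw F.step x := by
  obtain ⟨φ, rfl⟩ := exists_eq_comp_frestrictLe hΦ
  let κ : (k : ℕ) → Kernel ((i : Finset.Iic k) → S) S := fun k =>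
    F.step.comap (fun h : (i : Finset.Iic k) → S => h ⟨k, Finset.mem_Iic.2 le_rfl⟩)
      (measurable_pi_apply _)
  have hB0 : ∀ h : Finset.Iic n → S, |φ h| ≤ B := fun h => by
    have := hB (fun k => h ⟨min k n, Finset.mem_Iic.2 (min_le_right _ _)⟩)
    convert this using 2
    simp only [Function.comp]
    congr 1
    ext i
    have : min (i : ℕ) n = i := min_eq_left (Finset.mem_Iic.1 i.2)
    simp [Preorder.frestrictLe, this]
  -- Disintegration at time `n`: draw the history, then continue the chain from it. Since `u` takes
  -- history and continuation separately, the history is a constant in the inner integral.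
  have key : ∀ u : (Finset.Iic n → S) → (ℕ → S) → ℝ, Measurable u.uncurry →
      (∀ h X, |u h X| ≤ B * B') →
      ∫ h, ∫ X, u h X ∂Kernel.traj (X := fun _ : ℕ => S) κ n h
        ∂Kernel.partialTraj (X := fun _ : ℕ => S) κ 0 n (fun _ => x) =
      ∫ X, u (Preorder.frestrictLe (π := fun _ : ℕ => S) n X) X ∂chainLaw F.step x := by
    intro u hu hb
    exact Kernel.integral_traj_partialTraj' (X := fun _ : ℕ => S) (κ := κ) (Nat.zero_le n)
      (.of_bound hu.aestronglyMeasurable (B * B') (.of_forall fun _ => hb _ _))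
  have hBn : 0 ≤ B := (abs_nonneg _).trans (hB (fun _ => x))
  have h1 := key (fun h X => φ h * g (X (n + 1)))
    (((Measurable.of_discrete (f := φ)).comp measurable_fst).mul
      ((Measurable.of_discrete (f := g)).comp ((measurable_pi_apply _).comp measurable_snd)))
    (fun h X => by rw [abs_mul]; exact mul_le_mul (hB0 _) (hB' _) (abs_nonneg _) hBn)
  have h2 := key (fun h X => φ h * F.avg g (h ⟨n, Finset.mem_Iic.2 le_rfl⟩))
    ((Measurable.of_discrete (f := fun h : Finset.Iic n → S =>
      φ h * F.avg g (h ⟨n, Finset.mem_Iic.2 le_rfl⟩))).comp measurable_fst)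
    (fun h X => by
      rw [abs_mul]; exact mul_le_mul (hB0 _) (F.abs_avg_le hB' _) (abs_nonneg _) hBn)
  refine h1.symm.trans (Eq.trans ?_ h2)
  congr 1
  ext h
  rw [integral_const_mul, integral_const]
  rw [probReal_univ, one_smul]
  congr 1
  have h3 : (Kernel.traj (X := fun _ : ℕ => S) κ n h).map (fun X => X (n + 1)) = κ n h := by
    rw [← Kernel.map_apply _ (measurable_pi_apply _), Kernel.map_traj_succ_self]
  rw [← F.integral_step]
  change _ = ∫ y, g y ∂(κ n h)
  rw [← h3, integral_map (measurable_pi_apply _).aemeasurable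
    Measurable.of_discrete.aestronglyMeasurable]

theorem DIFS.integral_mul_increment {n : ℕ} {Φ : (ℕ → S) → ℝ} (hΦ : DependsOn Φ (Set.Iic n))
    {B : ℝ} (hB : ∀ X, |Φ X| ≤ B) {g : S → ℝ} {B' : ℝ} (hB' : ∀ y, |g y| ≤ B') :
    ∫ X, Φ X * (g (X (n + 1)) - F.avg g (X n)) ∂chainLaw F.step x = 0 := by
  have hBn : 0 ≤ B := (abs_nonneg _).trans (hB (fun _ => x))
  simp only [mul_sub]
  rw [integral_sub, F.integral_mul_next x hΦ hB hB', sub_self]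
  · refine integrable_of_dependsOn (n := n + 1) (B := B * B') (fun X Y h => ?_) (fun X => ?_) _
    · rw [hΦ fun i (hi : i ≤ n) => h i (hi.trans n.le_succ), h (n + 1) (le_refl (n + 1))]
    · rw [abs_mul]; exact mul_le_mul (hB _) (hB' _) (abs_nonneg _) hBn
  · refine integrable_of_dependsOn (n := n + 1) (B := B * B') (fun X Y h => ?_) (fun X => ?_) _
    · rw [hΦ fun i (hi : i ≤ n) => h i (hi.trans n.le_succ), h n n.le_succ]
    · rw [abs_mul]; exact mul_le_mul (hB _) (F.abs_avg_le hB' _) (abs_nonneg _) hBn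

/-- Almost surely, all the steps of the chain are given by the maps. -/
theorem DIFS.ae_edge : ∀ᵐ X ∂chainLaw F.step x, ∀ k, F.Edge (X k) (X (k + 1)) := by
  classical
  rw [ae_all_iff]
  intro k
  have h : ∀ a b, ¬ F.Edge a b → ∀ᵐ X ∂chainLaw F.step x, ¬ (X k = a ∧ X (k + 1) = b) := by
    intro a b hab
    -- Testing with the indicators of `a` and `b`, the right side contains `avg` of the indicator of
    -- `b` at `a`, which is 0 for a non-edge.
    have h1 := F.integral_mul_next x (n := k) (Φ := fun X => if X k = a then 1 else 0)
      (fun X Y h => by simp only [h k (le_refl k)]) (B := 1) (fun X => by split_ifs <;> simp)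
      (g := fun y => if y = b then 1 else 0) (B' := 1) (fun X => by split_ifs <;> simp)
    have h2 : ∀ X : ℕ → S, (if X k = a then (1 : ℝ) else 0) *
        F.avg (fun y => if y = b then 1 else 0) (X k) = 0 := by
      intro X
      by_cases hX : X k = a
      · rw [F.avg_eq_of_forall_eq (m := 0), mul_zero]
        intro i
        rw [if_neg]
        exact fun h => hab ⟨i, hX ▸ h⟩
      · simp [hX]
    simp only [h2, integral_zero] at h1
    rw [integral_eq_zero_iff_of_nonneg] at h1
    · filter_upwards [h1] with X hX hXab
      simp [hXab.1, hXab.2] at hX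
    · intro X
      simp only [Pi.zero_apply]
      positivity
    · refine integrable_of_dependsOn (n := k + 1) (B := 1) (fun X Y h => ?_) (fun X => ?_) _
      · rw [h k k.le_succ, h (k + 1) (le_refl (k + 1))]
      · split_ifs <;> simp
  have h' : ∀ᵐ X ∂chainLaw F.step x, ∀ a b, ¬ F.Edge a b → ¬ (X k = a ∧ X (k + 1) = b) := by
    rw [ae_all_iff]; intro a
    rw [ae_all_iff]; intro b
    by_cases hab : F.Edge a b
    · simp [hab]
    · filter_upwards [h a b hab] with X hX _ using hX
  filter_upwards [h'] with X hX
  by_contra hk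
  exact hX _ _ hk ⟨rfl, rfl⟩

/-- By the Markov property the probability is that of `A` times the average at `y` of the indicator
of `z`; the latter is positive because the weight of the edge is. -/
theorem DIFS.measure_pos_step {n : ℕ} {A : Set (ℕ → S)} (hA : DependsOn (· ∈ A) (Set.Iic n))
    {y z : S} (hAy : ∀ X ∈ A, X n = y) (hyz : F.Edge y z) (hpos : 0 < chainLaw F.step x A) :
    0 < chainLaw F.step x (A ∩ {X | X (n + 1) = z}) := by
  classical
  obtain ⟨i, rfl⟩ := hyz
  have hmA : MeasurableSet A := measurableSet_setOfPred.2 (measurable_of_dependsOn hA)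
  have h1 := F.integral_mul_next x (n := n) (Φ := A.indicator 1)
    (fun X Y h => by
      have := hA h
      simp only [eq_iff_iff] at this
      by_cases hX : X ∈ A
      · rw [Set.indicator_of_mem hX, Set.indicator_of_mem (this.1 hX)]; rfl
      · rw [Set.indicator_of_notMem hX, Set.indicator_of_notMem (fun hY => hX (this.2 hY))])
    (B := 1) (fun X => by by_cases hX : X ∈ A <;> simp [hX])
    (g := fun u => if u = F.map i y then 1 else 0) (B' := 1) (fun X => by split_ifs <;> simp)
  by_contra h0
  rw [not_lt, nonpos_iff_eq_zero] at h0
  have h2 : ∫ X, A.indicator 1 X * (if X (n + 1) = F.map i y then (1 : ℝ) else 0)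
      ∂chainLaw F.step x = 0 := by
    rw [integral_eq_zero_of_ae]
    have : ∀ᵐ X ∂chainLaw F.step x, X ∉ A ∩ {X | X (n + 1) = F.map i y} :=
      measure_eq_zero_iff_ae_notMem.1 h0
    filter_upwards [this] with X hX
    by_cases hXA : X ∈ A
    · have : X (n + 1) ≠ F.map i y := fun h => hX ⟨hXA, h⟩
      simp [this]
    · simp [hXA]
  rw [h2] at h1
  have h3 : ∀ X : ℕ → S, A.indicator 1 X * F.avg (fun u => if u = F.map i y then 1 else 0) (X n) =
      A.indicator (fun _ => F.avg (fun u => if u = F.map i y then 1 else 0) y) X := by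
    intro X
    by_cases hX : X ∈ A
    · simp [hX, hAy X hX]
    · simp [hX]
  simp only [h3] at h1
  rw [integral_indicator_const _ hmA, smul_eq_mul, zero_eq_mul] at h1
  rcases h1 with h1 | h1
  · rw [measureReal_def, ENNReal.toReal_eq_zero_iff] at h1
    rcases h1 with h1 | h1
    · exact hpos.ne' h1
    · exact measure_ne_top _ _ h1
  · have h4 := F.eq_of_avg_le (g := fun u => if u = F.map i y then (1 : ℝ) else 0) (x := y) (m := 0)
      (fun j => by split_ifs <;> simp) h1.le i
    simp at h4

theorem DIFS.accessible_iff (y : S) : Accessible F.step x y ↔ F.Reach x y := by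
  constructor
  · rintro ⟨k, hk⟩
    by_contra h
    refine hk.ne' (measure_eq_zero_iff_ae_notMem.2 ?_)
    filter_upwards [chainLaw_zero F.step x, F.ae_edge x] with X h0 hX hXk
    apply h
    rw [← h0, ← show X k = y from hXk]
    exact DIFS.reach_of_orbit hX (Nat.zero_le k)
  · intro h
    induction h with
    | refl =>
      refine ⟨0, ?_⟩
      by_contra h0
      rw [not_lt, nonpos_iff_eq_zero, measure_eq_zero_iff_ae_notMem] at h0
      obtain ⟨X, hX, hX'⟩ := (h0.and (chainLaw_zero F.step x)).exists
      exact hX hX'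
    | @tail b c _ hbc ih =>
      obtain ⟨k, hk⟩ := ih
      exact ⟨k + 1, (F.measure_pos_step x (A := {X | X k = b})
        (fun X Y h => by simp [h k (le_refl k)]) (fun X hX => hX) hbc hk).trans_le
          (measure_mono Set.inter_subset_right)⟩

/-! ### Fourth-moment law of large numbers. -/

/-- The martingale of the deviations of `g (X (k + 1))` from its conditional expectations. -/
noncomputable def DIFS.martingale (F : DIFS S N) (g : S → ℝ) (n : ℕ) (X : ℕ → S) : ℝ :=
  ∑ k ∈ Finset.range n, (g (X (k + 1)) - F.avg g (X k))

omit [Countable S] [MeasurableSpace S] [MeasurableSingletonClass S] in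
theorem DIFS.dependsOn_martingale (g : S → ℝ) (n : ℕ) :
    DependsOn (F.martingale g n) (Set.Iic n) := by
  intro X Y h
  refine Finset.sum_congr rfl fun k hk => ?_
  rw [h (k + 1) (Finset.mem_range.1 hk), h k (Finset.mem_range.1 hk).le]

omit [Countable S] [MeasurableSpace S] [MeasurableSingletonClass S] in
theorem DIFS.abs_increment_le {g : S → ℝ} {B : ℝ} (hB : ∀ y, |g y| ≤ B) (y z : S) :
    |g y - F.avg g z| ≤ 2 * B := by
  have := abs_sub (g y) (F.avg g z)
  linarith [hB y, F.abs_avg_le hB z]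

omit [Countable S] [MeasurableSpace S] [MeasurableSingletonClass S] in
theorem DIFS.abs_martingale_le {g : S → ℝ} {B : ℝ} (hB : ∀ y, |g y| ≤ B) (n : ℕ) (X : ℕ → S) :
    |F.martingale g n X| ≤ n * (2 * B) := by
  refine (Finset.abs_sum_le_sum_abs _ _).trans ?_
  refine (Finset.sum_le_sum fun k _ => F.abs_increment_le hB _ _).trans ?_
  simp

theorem DIFS.integrable_martingale_pow {g : S → ℝ} {B : ℝ} (hB : ∀ y, |g y| ≤ B) (n p : ℕ)
    (μ : Measure (ℕ → S)) [IsFiniteMeasure μ] : Integrable (fun X => F.martingale g n X ^ p) μ := by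
  refine integrable_of_dependsOn (n := n) (B := (n * (2 * B)) ^ p) (fun X Y h => ?_)
    (fun X => ?_) _
  · simp only [F.dependsOn_martingale g n h]
  · rw [abs_pow]
    exact pow_le_pow_left₀ (abs_nonneg _) (F.abs_martingale_le hB n X) p

omit [Countable S] [MeasurableSpace S] [MeasurableSingletonClass S] in
theorem DIFS.martingale_succ (g : S → ℝ) (n : ℕ) (X : ℕ → S) :
    F.martingale g (n + 1) X = F.martingale g n X + (g (X (n + 1)) - F.avg g (X n)) :=
  Finset.sum_range_succ _ _

theorem DIFS.integral_martingale_pow_mul {g : S → ℝ} {B : ℝ} (hB : ∀ y, |g y| ≤ B) (n p : ℕ) :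
    ∫ X, F.martingale g n X ^ p * (g (X (n + 1)) - F.avg g (X n)) ∂chainLaw F.step x = 0 := by
  refine F.integral_mul_increment x (Φ := fun X => F.martingale g n X ^ p)
    (B := (n * (2 * B)) ^ p) (fun X Y h => ?_) (fun X => ?_) hB
  · simp only [F.dependsOn_martingale g n h]
  · rw [abs_pow]
    exact pow_le_pow_left₀ (abs_nonneg _) (F.abs_martingale_le hB n X) p

theorem DIFS.integrable_martingale_pow_mul {g : S → ℝ} {B : ℝ} (hB : ∀ y, |g y| ≤ B) (n p : ℕ)
    (μ : Measure (ℕ → S)) [IsFiniteMeasure μ] :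
    Integrable (fun X => F.martingale g n X ^ p * (g (X (n + 1)) - F.avg g (X n))) μ := by
  refine integrable_of_dependsOn (n := n + 1) (B := (n * (2 * B)) ^ p * (2 * B)) (fun X Y h => ?_)
    (fun X => ?_) _
  · rw [F.dependsOn_martingale g n fun i (hi : i ≤ n) => h i (hi.trans n.le_succ),
      h (n + 1) (le_refl (n + 1)), h n n.le_succ]
  · rw [abs_mul, abs_pow]
    have h1 := pow_le_pow_left₀ (abs_nonneg _) (F.abs_martingale_le hB n X) p
    exact mul_le_mul h1 (F.abs_increment_le hB _ _) (abs_nonneg _)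
      ((pow_nonneg (abs_nonneg _) p).trans h1)

theorem DIFS.integral_martingale_sq_le {g : S → ℝ} {B : ℝ} (hB : ∀ y, |g y| ≤ B) (n : ℕ) :
    ∫ X, F.martingale g n X ^ 2 ∂chainLaw F.step x ≤ n * (2 * B) ^ 2 := by
  induction n with
  | zero => simp [DIFS.martingale]
  | succ n ih =>
    have h1 := F.integrable_martingale_pow hB n 2 (chainLaw F.step x)
    have h2 := F.integrable_martingale_pow_mul hB n 1 (chainLaw F.step x)
    have h12 : Integrable (fun X => F.martingale g n X ^ 2 +
        2 * (F.martingale g n X ^ 1 * (g (X (n + 1)) - F.avg g (X n)))) (chainLaw F.step x) :=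
      h1.add (h2.const_mul 2)
    calc ∫ X, F.martingale g (n + 1) X ^ 2 ∂chainLaw F.step x
        ≤ ∫ X, (F.martingale g n X ^ 2 +
            2 * (F.martingale g n X ^ 1 * (g (X (n + 1)) - F.avg g (X n))) + (2 * B) ^ 2)
            ∂chainLaw F.step x := by
          refine integral_mono (F.integrable_martingale_pow hB (n + 1) 2 _)
            (h12.add (integrable_const _)) fun X => ?_
          have hD := F.abs_increment_le hB (X (n + 1)) (X n)
          have hD2 := sq_le_sq' (by linarith [neg_abs_le (g (X (n + 1)) - F.avg g (X n))])
            ((le_abs_self _).trans hD)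
          simp only [DIFS.martingale_succ]
          nlinarith
      _ = ∫ X, F.martingale g n X ^ 2 ∂chainLaw F.step x + (2 * B) ^ 2 := by
          rw [integral_add h12 (integrable_const _),
            integral_add h1 (h2.const_mul 2), integral_const_mul,
            F.integral_martingale_pow_mul x hB]
          simp
      _ ≤ _ := by
          push_cast
          linarith

/-- Growth of order `n ^ 2` makes the fourth moments of `martingale / n` summable. The constant 4
closes the induction, as 4n² + 8n + 3 ≤ 4(n + 1)²; the terms linear in the increment have mean zero.
-/
theorem DIFS.integral_martingale_pow_four_le {g : S → ℝ} {B : ℝ} (hB : ∀ y, |g y| ≤ B) (n : ℕ) :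
    ∫ X, F.martingale g n X ^ 4 ∂chainLaw F.step x ≤ 4 * n ^ 2 * (2 * B) ^ 4 := by
  induction n with
  | zero => simp [DIFS.martingale]
  | succ n ih =>
    have h1 := F.integrable_martingale_pow hB n 4 (chainLaw F.step x)
    have h2 := F.integrable_martingale_pow_mul hB n 3 (chainLaw F.step x)
    have h3 := F.integrable_martingale_pow hB n 2 (chainLaw F.step x)
    have h12 : Integrable (fun X => F.martingale g n X ^ 4 +
        4 * (F.martingale g n X ^ 3 * (g (X (n + 1)) - F.avg g (X n)))) (chainLaw F.step x) :=
      h1.add (h2.const_mul 4)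
    have h123 : Integrable (fun X => F.martingale g n X ^ 4 +
        4 * (F.martingale g n X ^ 3 * (g (X (n + 1)) - F.avg g (X n))) +
        8 * (2 * B) ^ 2 * F.martingale g n X ^ 2) (chainLaw F.step x) :=
      h12.add (h3.const_mul _)
    calc ∫ X, F.martingale g (n + 1) X ^ 4 ∂chainLaw F.step x
        ≤ ∫ X, (F.martingale g n X ^ 4 +
            4 * (F.martingale g n X ^ 3 * (g (X (n + 1)) - F.avg g (X n))) +
            8 * (2 * B) ^ 2 * F.martingale g n X ^ 2 + 3 * (2 * B) ^ 4)
            ∂chainLaw F.step x := by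
          refine integral_mono (F.integrable_martingale_pow hB (n + 1) 4 _)
            (h123.add (integrable_const _))
            fun X => ?_
          have hD := F.abs_increment_le hB (X (n + 1)) (X n)
          have hD2 := sq_le_sq' (by linarith [neg_abs_le (g (X (n + 1)) - F.avg g (X n))])
            ((le_abs_self _).trans hD)
          simp only [DIFS.martingale_succ]
          generalize g (X (n + 1)) - F.avg g (X n) = d at *
          generalize F.martingale g n X = m
          -- From d²(m - d)² ≥ 0. Absorbing the odd term turns the coefficients 6 and 1 of m²d² and
          -- d⁴ into 8 and 3.
          have e1 : 4 * m * d ^ 3 ≤ 2 * (m ^ 2 * d ^ 2) + 2 * d ^ 4 := by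
            nlinarith [mul_nonneg (sq_nonneg d) (sq_nonneg (m - d))]
          have e2 : m ^ 2 * d ^ 2 ≤ m ^ 2 * (2 * B) ^ 2 :=
            mul_le_mul_of_nonneg_left hD2 (sq_nonneg m)
          have e3 : d ^ 4 ≤ (2 * B) ^ 4 := by
            have := pow_le_pow_left₀ (sq_nonneg d) hD2 2
            calc d ^ 4 = (d ^ 2) ^ 2 := by ring
              _ ≤ _ := this
              _ = _ := by ring
          have e4 : (m + d) ^ 4 = m ^ 4 + 4 * (m ^ 3 * d) + 6 * (m ^ 2 * d ^ 2) + 4 * m * d ^ 3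
            + d ^ 4 := by ring
          rw [e4]
          linarith
      _ = ∫ X, F.martingale g n X ^ 4 ∂chainLaw F.step x +
          8 * (2 * B) ^ 2 * ∫ X, F.martingale g n X ^ 2 ∂chainLaw F.step x + 3 * (2 * B) ^ 4 := by
          rw [integral_add h123 (integrable_const _),
            integral_add h12 (h3.const_mul _),
            integral_add h1 (h2.const_mul 4), integral_const_mul, integral_const_mul,
            F.integral_martingale_pow_mul x hB]
          simp
      _ ≤ 4 * n ^ 2 * (2 * B) ^ 4 + 8 * (2 * B) ^ 2 * (n * (2 * B) ^ 2) + 3 * (2 * B) ^ 4 := by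
          have := mul_le_mul_of_nonneg_left (F.integral_martingale_sq_le x hB n)
            (by positivity : 0 ≤ 8 * (2 * B) ^ 2)
          linarith
      _ ≤ _ := by
          push_cast
          have : 0 ≤ B ^ 4 := by positivity
          nlinarith

/-- The law of large numbers for the martingale of a bounded function. -/
theorem DIFS.tendsto_martingale_div {g : S → ℝ} {B : ℝ} (hB : ∀ y, |g y| ≤ B) :
    ∀ᵐ X ∂chainLaw F.step x,
      Filter.Tendsto (fun n : ℕ => F.martingale g n X / n) Filter.atTop (nhds 0) := by
  have hmeas : ∀ n : ℕ, Measurable fun X => ENNReal.ofReal ((F.martingale g n X / n) ^ 4) :=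
    fun n => (((measurable_of_dependsOn (F.dependsOn_martingale g n)).div_const _).pow_const
      _).ennreal_ofReal
  have hle : ∀ n : ℕ, ∫⁻ X, ENNReal.ofReal ((F.martingale g n X / n) ^ 4) ∂chainLaw F.step x ≤
      ENNReal.ofReal (4 * (2 * B) ^ 4 * (1 / (n : ℝ) ^ 2)) := by
    intro n
    rw [← ofReal_integral_eq_lintegral_ofReal]
    · refine ENNReal.ofReal_le_ofReal ?_
      simp only [div_pow]
      rw [integral_div]
      rcases Nat.eq_zero_or_pos n with rfl | hn
      · simp
      · have hn' : (0 : ℝ) < n := Nat.cast_pos.2 hn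
        rw [div_le_iff₀ (by positivity)]
        refine (F.integral_martingale_pow_four_le x hB n).trans (le_of_eq ?_)
        field_simp
    · simp only [div_pow]
      exact (F.integrable_martingale_pow hB n 4 _).div_const _
    · exact .of_forall fun X => by simp only [Pi.zero_apply]; positivity
  -- A series with finite expectation is almost surely finite, so its terms tend to 0.
  have hsum : ∫⁻ X, ∑' n : ℕ, ENNReal.ofReal ((F.martingale g n X / n) ^ 4)
      ∂chainLaw F.step x ≠ ⊤ := by
    rw [lintegral_tsum fun n => (hmeas n).aemeasurable]
    refine ne_top_of_le_ne_top ?_ (ENNReal.tsum_le_tsum hle)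
    have : Summable fun n : ℕ => 4 * (2 * B) ^ 4 * (1 / (n : ℝ) ^ 2) :=
      (Real.summable_one_div_nat_pow.2 one_lt_two).mul_left _
    rw [← ENNReal.ofReal_tsum_of_nonneg (fun n => by positivity) this]
    exact ENNReal.ofReal_ne_top
  filter_upwards [ae_lt_top (Measurable.tsum hmeas) hsum] with X hX
  have h1 := ENNReal.tendsto_atTop_zero_of_tsum_ne_top hX.ne
  have h2 := (ENNReal.tendsto_toReal ENNReal.zero_ne_top).comp h1
  have h3 : Filter.Tendsto (fun n : ℕ => (F.martingale g n X / n) ^ 4) Filter.atTop (nhds 0) := by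
    refine h2.congr fun n => ?_
    exact ENNReal.toReal_ofReal (by positivity)
  have h4 := (Real.continuous_sqrt.tendsto _).comp ((Real.continuous_sqrt.tendsto _).comp h3)
  simp only [Real.sqrt_zero] at h4
  rw [tendsto_zero_iff_abs_tendsto_zero]
  refine h4.congr fun n => ?_
  simp only [Function.comp]
  rw [show (F.martingale g n X / n) ^ 4 = ((F.martingale g n X / n) ^ 2) ^ 2 by ring,
    Real.sqrt_sq (sq_nonneg _), Real.sqrt_sq_eq_abs]

/-- Almost surely, the law of large numbers holds for all finitely supported functions. -/
theorem DIFS.ae_tendsto_martingale_div : ∀ᵐ X ∂chainLaw F.step x,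
    ∀ (T : Set S) (g : S → ℝ), T.Finite → (∀ y ∉ T, g y = 0) →
      Filter.Tendsto (fun n : ℕ => F.martingale g n X / n) Filter.atTop (nhds 0) := by
  classical
  -- One null set must serve uncountably many `g`: it is taken from the countably many indicators,
  -- and linearity does the rest.
  have h : ∀ᵐ X ∂chainLaw F.step x, ∀ y : S, Filter.Tendsto
      (fun n : ℕ => F.martingale (Pi.single y 1) n X / n) Filter.atTop (nhds 0) := by
    rw [ae_all_iff]
    exact fun y => F.tendsto_martingale_div x (B := 1) fun z => by
      by_cases hz : z = y
      · subst hz; simp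
      · simp [hz]
  filter_upwards [h] with X hX T g hT hg
  have hsum : g = ∑ y ∈ hT.toFinset, g y • (Pi.single y 1 : S → ℝ) := by
    ext z
    rw [Finset.sum_apply]
    by_cases hz : z ∈ T
    · rw [Finset.sum_eq_single z]
      · simp
      · intro b _ hb
        simp [hb.symm]
      · simp [hz]
    · rw [hg z hz, Finset.sum_eq_zero]
      intro b hb
      have : z ≠ b := fun h => hz (h ▸ hT.mem_toFinset.1 hb)
      simp [this]
  have hlin : ∀ n : ℕ, F.martingale g n X / n =
      ∑ y ∈ hT.toFinset, g y * (F.martingale (Pi.single y 1) n X / n) := by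
    intro n
    conv_lhs => rw [hsum]
    simp only [DIFS.martingale, map_sum, map_smul, Finset.sum_apply, Pi.smul_apply, smul_eq_mul,
      ← Finset.sum_sub_distrib, ← mul_sub]
    rw [Finset.sum_comm, Finset.sum_div]
    refine Finset.sum_congr rfl fun y _ => ?_
    rw [← Finset.mul_sum, mul_div_assoc]
  simp only [hlin]
  have := tendsto_finsetSum hT.toFinset fun y _ => (hX y).const_mul (g y)
  simpa using this

omit [Countable S] [MeasurableSpace S] [MeasurableSingletonClass S] in
/-- If `f - a` is eventually of the form `g - avg g` along an orbit, the averages of `f` along the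
orbit tend to `a`. -/
theorem DIFS.tendsto_average {f g : S → ℝ} {a B : ℝ} (hB : ∀ y, |g y| ≤ B) {X : ℕ → S}
    (hM : Filter.Tendsto (fun n : ℕ => F.martingale g n X / n) Filter.atTop (nhds 0)) {m : ℕ}
    (h : ∀ i ≥ m, f (X i) - a = g (X i) - F.avg g (X i)) :
    Filter.Tendsto (fun n : ℕ => (1 / (n : ℝ)) * ∑ i ∈ Finset.range n, f (X i))
      Filter.atTop (nhds a) := by
  set r : ℕ → ℝ := fun i => f (X i) - a - (g (X i) - F.avg g (X i)) with hr
  have hR : ∀ n ≥ m, ∑ i ∈ Finset.range n, r i = ∑ i ∈ Finset.range m, r i := by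
    intro n hn
    refine (Finset.sum_subset (Finset.range_mono hn) fun i _ hi => ?_).symm
    rw [Finset.mem_range, not_lt] at hi
    exact sub_eq_zero.2 (h i hi)
  -- Writing g(X_i) - Pg(X_i) as a martingale increment plus g(X_i) - g(X_{i+1}), the latter
  -- telescopes. The sum of the errors `r` stops changing at `m`, so the last bracket stays bounded.
  have hkey : ∀ n : ℕ, ∑ i ∈ Finset.range n, f (X i) =
      n * a + F.martingale g n X + (∑ i ∈ Finset.range n, r i + g (X 0) - g (X n)) := by
    intro n
    induction n with
    | zero => simp [DIFS.martingale]
    | succ n ih =>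
      rw [Finset.sum_range_succ, ih, Finset.sum_range_succ, DIFS.martingale_succ]
      push_cast
      simp only [hr]
      ring
  have hrest : Filter.Tendsto (fun n : ℕ =>
      (∑ i ∈ Finset.range m, r i + g (X 0) - g (X n)) / (n : ℝ)) Filter.atTop (nhds 0) := by
    refine squeeze_zero_norm (a := fun n : ℕ => (|∑ i ∈ Finset.range m, r i| + 2 * B) / (n : ℝ))
      (fun n => ?_) (tendsto_const_nhds.div_atTop tendsto_natCast_atTop_atTop)
    rw [Real.norm_eq_abs, abs_div, Nat.abs_cast]
    refine div_le_div_of_nonneg_right ?_ (Nat.cast_nonneg n)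
    have h1 := abs_sub (∑ i ∈ Finset.range m, r i + g (X 0)) (g (X n))
    have h2 := abs_add_le (∑ i ∈ Finset.range m, r i) (g (X 0))
    linarith [hB (X 0), hB (X n)]
  have := (hM.add hrest).const_add a
  rw [add_zero, add_zero] at this
  refine this.congr' ?_
  filter_upwards [Filter.eventually_ge_atTop m, Filter.eventually_gt_atTop 0] with n hn hn0
  have hn0' : (n : ℝ) ≠ 0 := Nat.cast_ne_zero.2 hn0.ne'
  rw [hkey n, hR n hn]
  field_simp
  ring

omit [Countable S] [MeasurableSpace S] [MeasurableSingletonClass S] in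
theorem DIFS.mem_of_orbit {C : Set S} (hC : ∀ x ∈ C, ∀ i, F.map i x ∈ C) {X : ℕ → S}
    (hX : ∀ k, F.Edge (X k) (X (k + 1))) {m : ℕ} (hm : X m ∈ C) : ∀ i ≥ m, X i ∈ C :=
  fun _ hi => F.mem_of_reach hC hm (DIFS.reach_of_orbit hX hi)

/-- On the non-essential part of `K`, which can be left, solve `g - avg g = 1`. An orbit that never
becomes essential ends up there for good, and the averages of the constant 1 along it would tend to
0. -/
theorem DIFS.Attracts.ae_exists_essential {F : DIFS S N} {K : Set S} (hK : F.Attracts K) (x : S) :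
    ∀ᵐ X ∂chainLaw F.step x, ∃ k, F.Essential (X k) := by
  have hT : (K \ {y | F.Essential y}).Finite := hK.finite.subset Set.sdiff_subset
  obtain ⟨g, hg0, hg⟩ := F.exists_dirichlet hT (fun y _ => by
    obtain ⟨z, hyz, hz⟩ := hK.exists_essential y
    exact ⟨z, fun h => h.2 hz, hyz⟩) 1
  obtain ⟨B, -, hB⟩ := exists_abs_le_of_finite hT hg0
  filter_upwards [F.ae_edge x, F.ae_tendsto_martingale_div x] with X hX hM
  by_contra! hne
  obtain ⟨m, hm⟩ := hK.exists_mem X hX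
  have h0 := F.tendsto_average (f := 1) (a := 0) hB (hM _ g hT hg0) (m := m) fun i hi => by
    rw [hg _ ⟨F.mem_of_orbit hK.map_mem hX hm i hi, hne i⟩, sub_zero]
  have h1 := F.tendsto_average (f := 1) (g := 0) (a := 1) (B := 0) (X := X) (m := 0) (by simp)
    (by simp [DIFS.martingale]) (by simp)
  exact zero_ne_one (tendsto_nhds_unique h0 h1)

/-! ### Recurrence -/

theorem measurable_returnTime : Measurable (returnTime x) := by
  refine Measurable.iInf fun k => ?_
  refine measurable_of_dependsOn (n := k) fun X Y h => ?_
  rw [h k (le_refl k)]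

/-- The orbit `X` does not return to `x` before time `n + 1`. -/
def noReturn (x : S) (n : ℕ) : Set (ℕ → S) := {X | ∀ k, 1 ≤ k → k ≤ n → X k ≠ x}

omit [Countable S] [MeasurableSpace S] [MeasurableSingletonClass S] in
theorem dependsOn_noReturn (n : ℕ) : DependsOn (· ∈ noReturn x n) (Set.Iic n) := by
  intro X Y h
  refine propext (forall_congr' fun k => forall_congr' fun _ => forall_congr' fun hk => ?_)
  rw [h k hk]

theorem measurableSet_noReturn (n : ℕ) : MeasurableSet (noReturn x n) :=
  measurableSet_setOfPred.2 (measurable_of_dependsOn (dependsOn_noReturn x n))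

-- `noReturn x n` is the event that the return time exceeds `n`, so this is the tail-sum formula, of
-- which one inequality suffices.
omit [Countable S] [MeasurableSpace S] [MeasurableSingletonClass S] in
theorem returnTime_le_tsum (X : ℕ → S) :
    returnTime x X ≤ ∑' n, (noReturn x n).indicator (1 : (ℕ → S) → ℝ≥0∞) X := by
  classical
  by_cases h : ∃ k, 1 ≤ k ∧ X k = x
  · have h1 : returnTime x X ≤ (Nat.find h : ℕ) := iInf₂_le (Nat.find h) (Nat.find_spec h)
    refine h1.trans (le_trans ?_ (ENNReal.sum_le_tsum (Finset.range (Nat.find h))))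
    rw [Finset.sum_congr rfl (g := fun _ => 1)]
    · simp
    · intro n hn
      refine Set.indicator_of_mem (s := noReturn x n) (fun k hk hkn hX => ?_) _
      exact Nat.find_min h (hkn.trans_lt (Finset.mem_range.1 hn)) ⟨hk, hX⟩
  · have h1 : ∀ n, (noReturn x n).indicator (1 : (ℕ → S) → ℝ≥0∞) X = 1 := fun n =>
      Set.indicator_of_mem (s := noReturn x n) (fun k hk _ hX => h ⟨k, hk, hX⟩) _
    simp [h1]

theorem isPositiveRecurrent_of_summable (κ : Kernel S S) [IsMarkovKernel κ]
    (h : Summable fun n => (chainLaw κ x).real (noReturn x n)) : IsPositiveRecurrent κ x := by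
  have h1 : ∫⁻ X, returnTime x X ∂chainLaw κ x < ⊤ := by
    refine (lintegral_mono (returnTime_le_tsum x)).trans_lt ?_
    rw [lintegral_tsum fun n =>
      (measurable_one.indicator (measurableSet_noReturn x n)).aemeasurable]
    rw [tsum_congr fun n => lintegral_indicator_one (measurableSet_noReturn x n)]
    rw [tsum_congr fun n => (ofReal_measureReal (s := noReturn x n) (μ := chainLaw κ x)).symm,
      ← ENNReal.ofReal_tsum_of_nonneg (fun _ => measureReal_nonneg) h]
    exact ENNReal.ofReal_lt_top
  refine ⟨?_, h1⟩
  have h2 : ∀ᵐ X ∂chainLaw κ x, X ∈ {X : ℕ → S | ∃ k : ℕ, 1 ≤ k ∧ X k = x} := by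
    filter_upwards [ae_lt_top (measurable_returnTime x) h1.ne] with X hX
    by_contra hne
    replace hne : ∀ k, ¬ (1 ≤ k ∧ X k = x) := not_exists.1 hne
    simp [returnTime, hne] at hX
  exact (measure_congr (Filter.eventuallyEq_univ.2 h2)).trans measure_univ

/-- Take `g` with `g - avg g = 1` on `C` minus `x` and `g x = 0`. The means `J n` of `g (X n)` over
the paths with no return by time `n` are bounded, and their successive differences are the tails of
the return time, which are therefore summable. -/
theorem DIFS.IsFiniteClass.isPositiveRecurrent {F : DIFS S N} {C : Set S}
    (hC : F.IsFiniteClass C) {x : S} (hx : x ∈ C) : IsPositiveRecurrent F.step x := by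
  classical
  have hT : (C \ {x}).Finite := hC.finite.subset Set.sdiff_subset
  obtain ⟨g, hg0, hg⟩ := F.exists_dirichlet hT (fun y hy =>
    ⟨x, fun h => h.2 rfl, hC.reach y hy.1 x hx⟩) 1
  obtain ⟨B, -, hB⟩ := exists_abs_le_of_finite hT hg0
  set μ := chainLaw F.step x
  let J : ℕ → ℝ := fun n => ∫ X, (noReturn x n).indicator 1 X * g (X n) ∂μ
  have hind : ∀ n X, |(noReturn x n).indicator (1 : (ℕ → S) → ℝ) X| ≤ 1 := fun n X => by
    by_cases hX : X ∈ noReturn x n <;> simp [hX]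
  have hdep : ∀ n, DependsOn ((noReturn x n).indicator (1 : (ℕ → S) → ℝ)) (Set.Iic n) := by
    intro n X Y h
    have := dependsOn_noReturn x n h
    simp only [eq_iff_iff] at this
    by_cases hX : X ∈ noReturn x n
    · rw [Set.indicator_of_mem hX, Set.indicator_of_mem (this.1 hX)]; rfl
    · rw [Set.indicator_of_notMem hX, Set.indicator_of_notMem (fun hY => hX (this.2 hY))]
  have hJ : ∀ n, |J n| ≤ B := fun n => by
    have := norm_integral_le_of_norm_le_const (μ := μ) (C := B)
      (f := fun X => (noReturn x n).indicator 1 X * g (X n)) (.of_forall fun X => by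
        rw [Real.norm_eq_abs, abs_mul]
        calc _ ≤ 1 * B := mul_le_mul (hind n X) (hB _) (abs_nonneg _) zero_le_one
          _ = B := one_mul B)
    simpa using this
  have hstep : ∀ n, μ.real (noReturn x (n + 1)) = J (n + 1) - J (n + 2) := by
    intro n
    -- As `g x = 0`, a return exactly at time `n + 2` contributes nothing, so the event may be
    -- relaxed to time `n + 1`.
    have h1 : J (n + 2) = ∫ X, (noReturn x (n + 1)).indicator 1 X * g (X (n + 2)) ∂μ := by
      refine integral_congr_ae (.of_forall fun X => ?_)
      by_cases hX : X (n + 2) = x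
      · have : g x = 0 := hg0 x fun h => h.2 rfl
        simp [hX, this]
      · have : X ∈ noReturn x (n + 2) ↔ X ∈ noReturn x (n + 1) := by
          constructor
          · exact fun h k hk hkn => h k hk (hkn.trans (Nat.le_succ _))
          · intro h k hk hkn
            rcases Nat.le_succ_iff.1 hkn with hkn | rfl
            · exact h k hk hkn
            · exact hX
        by_cases h : X ∈ noReturn x (n + 1)
        · simp [h, this.2 h]
        · simp [h, mt this.1 h]
    rw [h1, F.integral_mul_next x (hdep (n + 1)) (hind (n + 1)) hB,
      ← integral_indicator_one (measurableSet_noReturn x (n + 1)), eq_sub_iff_add_eq,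
      ← integral_add]
    · refine integral_congr_ae ?_
      filter_upwards [F.ae_edge x, chainLaw_zero F.step x] with X hX h0
      by_cases h : X ∈ noReturn x (n + 1)
      · have hm := F.mem_of_orbit hC.map_mem hX (m := 0) (h0 ▸ hx) (n + 1) (Nat.zero_le _)
        have := hg (X (n + 1)) ⟨hm, h (n + 1) (by omega) le_rfl⟩
        simp only [Set.indicator_of_mem h, Pi.one_apply, one_mul] at this ⊢
        linarith
      · simp [h]
    · exact (integrable_const (1 : ℝ)).indicator (measurableSet_noReturn x (n + 1))
    · refine integrable_of_dependsOn (n := n + 1) (B := 1 * B) (fun X Y h => ?_) (fun X => ?_) _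
      · rw [hdep (n + 1) h, h (n + 1) (le_refl (n + 1))]
      · rw [abs_mul]
        exact mul_le_mul (hind _ X) (F.abs_avg_le hB _) (abs_nonneg _) zero_le_one
  -- The tail at 0 is left out: at time 0 the chain sits at `x`, where the equation for `g` is not
  -- imposed.
  refine isPositiveRecurrent_of_summable x _ ((summable_nat_add_iff 1).1 ?_)
  refine summable_of_sum_range_le (c := 2 * B) (fun _ => measureReal_nonneg) fun n => ?_
  have : ∀ n, ∑ i ∈ Finset.range n, μ.real (noReturn x (i + 1)) = J 1 - J (n + 1) := by
    intro n
    induction n with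
    | zero => simp
    | succ n ih => rw [Finset.sum_range_succ, ih, hstep n]; ring
  rw [this n]
  linarith [(abs_le.1 (hJ 1)).2, (abs_le.1 (hJ (n + 1))).1]

/-- A recurrent state can be reached from all the states to which it leads. -/
theorem DIFS.essential_of_isRecurrent {F : DIFS S N} {x : S} (h : IsRecurrent F.step x) :
    F.Essential x := by
  intro y hxy
  have hmeas : MeasurableSet {X : ℕ → S | ∃ k : ℕ, 1 ≤ k ∧ X k = x} := by
    refine measurableSet_setOfPred.2 (Measurable.exists fun k => ?_)
    refine measurable_of_dependsOn (n := k) fun X Y h => ?_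
    rw [h k (le_refl k)]
  have hrec := (mem_ae_iff_prob_eq_one hmeas).2 h
  have hbase : 0 < chainLaw F.step x (noReturn x 0 ∩ {X | X 0 = x}) := by
    by_contra h0
    rw [not_lt, nonpos_iff_eq_zero, measure_eq_zero_iff_ae_notMem] at h0
    obtain ⟨X, hX, hX'⟩ := (h0.and (chainLaw_zero F.step x)).exists
    exact hX ⟨fun k hk hk' => absurd (hk.trans hk') (by norm_num), hX'⟩
  -- Reaching `y` without passing through `x` again, by restarting the path at each visit to `x`.
  -- The almost sure return then happens no earlier than `n`, so it leads from `y` back to `x`.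
  have key : ∃ n, 0 < chainLaw F.step x (noReturn x n ∩ {X | X n = y}) := by
    induction hxy with
    | refl => exact ⟨0, hbase⟩
    | @tail b c _ hbc ih =>
      by_cases hc : c = x
      · exact ⟨0, hc ▸ hbase⟩
      · obtain ⟨n, hn⟩ := ih
        refine ⟨n + 1, (F.measure_pos_step x (n := n) (fun X Y hXY => ?_) (fun X hX => hX.2) hbc
          hn).trans_le (measure_mono fun X hX => ⟨fun k hk hkn => ?_, hX.2⟩)⟩
        · have h1 : (X ∈ noReturn x n) = (Y ∈ noReturn x n) := dependsOn_noReturn x n hXY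
          change (X ∈ noReturn x n ∧ X n = b) = (Y ∈ noReturn x n ∧ Y n = b)
          rw [hXY n (le_refl n), h1]
        · rcases Nat.le_succ_iff.1 hkn with hkn | rfl
          · exact hX.1.1 k hk hkn
          · rw [show X (n + 1) = c from hX.2]
            exact hc
  obtain ⟨n, hn⟩ := key
  by_contra hyx
  refine hn.ne' (measure_eq_zero_iff_ae_notMem.2 ?_)
  filter_upwards [hrec, F.ae_edge x] with X ⟨k, hk, hkx⟩ hX hXn
  apply hyx
  have hnk : n ≤ k := by
    by_contra! hkn
    exact hXn.1 k hk hkn.le hkx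
  rw [← hkx, ← show X n = y from hXn.2]
  exact DIFS.reach_of_orbit hX hnk

/-! ### Stationary measures -/

theorem integrable_of_abs_le {μ : Measure S} [IsFiniteMeasure μ] {f : S → ℝ} {B : ℝ}
    (hB : ∀ y, |f y| ≤ B) : Integrable f μ :=
  .of_bound Measurable.of_discrete.aestronglyMeasurable B (.of_forall hB)

theorem DIFS.integral_bind (π : Measure S) [IsFiniteMeasure π] {f : S → ℝ} {B : ℝ}
    (hB : ∀ y, |f y| ≤ B) : ∫ y, f y ∂(π.bind F.step) = ∫ y, F.avg f y ∂π := by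
  have h := Kernel.integral_comp (κ := Kernel.const Unit π) (η := F.step) (a := ())
    (f := f) (integrable_of_abs_le hB)
  rw [Kernel.comp_apply, Kernel.const_apply] at h
  rw [h]
  simp only [F.integral_step]

omit [Countable S] [MeasurableSpace S] [MeasurableSingletonClass S] in
theorem abs_single_le [DecidableEq S] (y z : S) : |(Pi.single y 1 : S → ℝ) z| ≤ 1 := by
  by_cases hz : z = y
  · subst hz; simp
  · simp [hz]

omit [Countable S] in
theorem integral_single [DecidableEq S] (π : Measure S) (y : S) :
    ∫ z, (Pi.single y 1 : S → ℝ) z ∂π = π.real {y} := by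
  rw [← integral_indicator_one (measurableSet_singleton y)]
  congr 1
  ext z
  by_cases hz : z = y
  · subst hz; simp
  · simp [hz]

theorem eq_of_integral_single_eq [DecidableEq S] {π π' : Measure S} [IsFiniteMeasure π]
    [IsFiniteMeasure π']
    (h : ∀ y, ∫ z, (Pi.single y 1 : S → ℝ) z ∂π = ∫ z, (Pi.single y 1 : S → ℝ) z ∂π') :
    π = π' := by
  refine Measure.ext_of_singleton fun y => ?_
  have := h y
  rwa [integral_single, integral_single, measureReal_eq_measureReal_iff] at this

/-- On a countable discrete space the indicators of points determine a finite measure, so testing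
with bounded functions is enough. -/
theorem DIFS.invariant_iff (π : Measure S) [IsFiniteMeasure π] :
    Kernel.Invariant F.step π ↔
      ∀ (f : S → ℝ) (B : ℝ), (∀ y, |f y| ≤ B) → ∫ y, F.avg f y ∂π = ∫ y, f y ∂π := by
  classical
  constructor
  · intro h f B hB
    rw [← F.integral_bind π hB]
    exact congrArg (fun μ : Measure S => ∫ y, f y ∂μ) h
  · intro h
    refine eq_of_integral_single_eq (π := π.bind F.step) fun y => ?_
    rw [F.integral_bind π (abs_single_le y)]
    exact h _ 1 (abs_single_le y)

/-- A finite class supports a stationary probability measure, whose integral is the constant of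
the Poisson equation. -/
theorem DIFS.IsFiniteClass.exists_isStationary {F : DIFS S N} {C : Set S}
    (hC : F.IsFiniteClass C) : ∃ π : Measure S, IsStationary F.step π ∧ atoms π = C ∧
      ∀ f : S → ℝ, ∃ g : S → ℝ, (∀ x ∉ C, g x = 0) ∧
        ∀ x ∈ C, f x - ∫ y, f y ∂π = g x - F.avg g x := by
  classical
  obtain ⟨p, hp, hp0, hpois⟩ := hC.exists_weights
  have hpnn : ∀ y, 0 ≤ p y := fun y => by
    by_cases hy : y ∈ C
    · exact (hp y hy).le
    · exact (hp0 y hy).ge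
  let π : Measure S := ∑ y ∈ hC.finite.toFinset, ENNReal.ofReal (p y) • Measure.dirac y
  have hint : ∀ f : S → ℝ, ∫ y, f y ∂π = ∑ y ∈ hC.finite.toFinset, p y * f y := by
    intro f
    rw [integral_finsetSum_measure]
    · refine Finset.sum_congr rfl fun y _ => ?_
      rw [integral_smul_measure, integral_dirac, ENNReal.toReal_ofReal (hpnn y), smul_eq_mul]
    · intro y _
      exact (integrable_dirac (by simp)).smul_measure ENNReal.ofReal_ne_top
  -- The constant 1 solves its Poisson equation with `g = 0` and `a = 1`.
  have hone : ∑ y ∈ hC.finite.toFinset, p y = 1 := by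
    have := hC.sum_eq_mean hpois (f := 1) (g := 0) (a := 1) (by simp)
    simpa using this
  have hprob : IsProbabilityMeasure π := by
    refine ⟨?_⟩
    rw [Measure.finsetSum_apply]
    simp only [Measure.smul_apply, measure_univ, smul_eq_mul, mul_one]
    rw [← ENNReal.ofReal_sum_of_nonneg fun y _ => hpnn y, hone, ENNReal.ofReal_one]
  refine ⟨π, ⟨hprob, (F.invariant_iff π).2 fun f B _ => ?_⟩, ?_, fun f => ?_⟩
  -- Invariance: `f - avg f` has the Poisson solution `f` with constant 0, so its weighted mean
  -- vanishes.
  · have := hC.sum_eq_mean hpois (f := f - F.avg f) (g := f) (a := 0) (by simp)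
    rw [hint, hint, eq_comm, ← sub_eq_zero, ← Finset.sum_sub_distrib]
    simpa [mul_sub] using this
  · ext z
    change 0 < π {z} ↔ z ∈ C
    have : π.real {z} = p z := by
      rw [← integral_single, hint]
      by_cases hz : z ∈ C
      · rw [Finset.sum_eq_single z]
        · simp
        · intro b _ hb
          simp [hb]
        · simp [hz]
      · rw [hp0 z hz, Finset.sum_eq_zero]
        intro b hb
        have : b ≠ z := fun h => hz (h ▸ hC.finite.mem_toFinset.1 hb)
        simp [this]
    rw [pos_iff_ne_zero, ne_eq, ← measureReal_eq_zero_iff, this]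
    exact ⟨fun h => by_contra fun hz => h (hp0 z hz), fun hz => (hp z hz).ne'⟩
  · obtain ⟨g, hg0, hg⟩ := hpois f
    exact ⟨g, hg0, fun x hx => by rw [hint]; exact hg x hx⟩

/-- Mixtures of stationary probability measures. -/
theorem DIFS.exists_isStationary_atoms_eq_sUnion {G : Set (Set S)} (hfin : G.Finite)
    (hne : G.Nonempty)
    (h : ∀ C ∈ G, ∃ π : Measure S, IsStationary F.step π ∧ atoms π = C) :
    ∃ π : Measure S, IsStationary F.step π ∧ atoms π = ⋃₀ G := by
  classical
  choose! π hπ hatoms using h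
  have hfs : hfin.toFinset.Nonempty := hfin.toFinset_nonempty.2 hne
  have hcard : (hfin.toFinset.card : ℝ≥0∞) ≠ 0 := by
    simpa using hfs.card_pos.ne'
  have hcard' : (hfin.toFinset.card : ℝ≥0∞) ≠ ⊤ := ENNReal.natCast_ne_top _
  let ν : Measure S := (hfin.toFinset.card : ℝ≥0∞)⁻¹ • ∑ C ∈ hfin.toFinset, π C
  have hp : ∀ C ∈ hfin.toFinset, IsProbabilityMeasure (π C) := fun C hC =>
    (hπ C (hfin.mem_toFinset.1 hC)).1
  have hprob : IsProbabilityMeasure ν := by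
    refine ⟨?_⟩
    rw [Measure.smul_apply, Measure.finsetSum_apply, Finset.sum_congr rfl fun C hC =>
      (hp C hC).measure_univ]
    simp [ENNReal.inv_mul_cancel hcard hcard']
  refine ⟨ν, ⟨hprob, (F.invariant_iff ν).2 fun f B hB => ?_⟩, ?_⟩
  · rw [integral_smul_measure, integral_smul_measure, integral_finsetSum_measure,
      integral_finsetSum_measure]
    · congr 1
      refine Finset.sum_congr rfl fun C hC => ?_
      have := hp C hC
      exact (F.invariant_iff (π C)).1 (hπ C (hfin.mem_toFinset.1 hC)).2 f B hB
    · intro C hC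
      have := hp C hC
      exact integrable_of_abs_le hB
    · intro C hC
      have := hp C hC
      exact integrable_of_abs_le (F.abs_avg_le hB)
  · ext z
    change 0 < ν {z} ↔ _
    rw [Measure.smul_apply, Measure.finsetSum_apply, smul_eq_mul, ENNReal.mul_pos_iff,
      pos_iff_ne_zero, pos_iff_ne_zero]
    simp only [ne_eq, ENNReal.inv_eq_zero, hcard', not_false_eq_true, true_and,
      Finset.sum_eq_zero_iff, not_forall, Set.mem_sUnion, Set.Finite.mem_toFinset]
    constructor
    · rintro ⟨C, hC, hz⟩
      refine ⟨C, hC, ?_⟩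
      rw [← hatoms C hC]
      exact pos_iff_ne_zero.2 hz
    · rintro ⟨C, hC, hz⟩
      refine ⟨C, hC, ?_⟩
      rw [← hatoms C hC] at hz
      exact (pos_iff_ne_zero.1 hz)

/-- A stationary measure is supported by every invariant set that can be reached from
everywhere. -/
theorem DIFS.ae_mem_of_isStationary {C : Set S} (hC : ∀ x ∈ C, ∀ i, F.map i x ∈ C)
    (hr : ∀ x, ∃ y ∈ C, F.Reach x y) {π : Measure S} (hπ : IsStationary F.step π) :
    ∀ᵐ y ∂π, y ∈ C := by
  classical
  have := hπ.1
  have hB : ∀ y, |C.indicator (1 : S → ℝ) y| ≤ 1 := fun y => by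
    by_cases hy : y ∈ C <;> simp [hy]
  have hinv := (F.invariant_iff π).1 hπ.2
  -- Invariance of `C` makes its indicator subharmonic; stationarity then forces equality at every
  -- atom, so no edge leads from an atom outside `C` into `C`. Positive mass propagates along edges,
  -- so such an atom could never reach `C`.
  have h0 : ∫ y, (F.avg (C.indicator 1) y - C.indicator 1 y) ∂π = 0 := by
    rw [integral_sub (integrable_of_abs_le (F.abs_avg_le hB)) (integrable_of_abs_le hB),
      hinv _ 1 hB, sub_self]
  rw [integral_eq_zero_iff_of_nonneg] at h0
  · have hout : ∀ y, π {y} ≠ 0 → y ∉ C → ∀ i, F.map i y ∉ C := by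
      intro y hy hyC i hi
      have h1 : F.avg (C.indicator 1) y - C.indicator 1 y = 0 := by
        by_contra hne
        refine hy (measure_mono_null (fun z hz => ?_) (ae_iff.1 h0))
        rw [Set.mem_singleton_iff.1 hz]
        exact hne
      rw [Set.indicator_of_notMem hyC, sub_zero] at h1
      have h2 := F.eq_of_avg_le (g := C.indicator 1) (x := y) (m := 0) (fun j =>
        Set.indicator_nonneg (fun _ _ => zero_le_one) _) h1.le i
      rw [Set.indicator_of_mem hi] at h2
      exact one_ne_zero h2
    have hatom : ∀ y, π {y} ≠ 0 → ∀ i, π {F.map i y} ≠ 0 := by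
      intro y hy i h1
      have h2 := hinv (Pi.single (F.map i y) 1) 1 (abs_single_le _)
      rw [integral_single, measureReal_def, h1, ENNReal.toReal_zero,
        integral_eq_zero_iff_of_nonneg] at h2
      · have h3 : F.avg (Pi.single (F.map i y) 1) y = 0 := by
          by_contra hne
          refine hy (measure_mono_null (fun z hz => ?_) (ae_iff.1 h2))
          rw [Set.mem_singleton_iff.1 hz]
          exact hne
        have h4 := F.eq_of_avg_le (x := y) (m := 0) (fun j => by
          by_cases hj : F.map j y = F.map i y
          · rw [hj, Pi.single_eq_same]; exact zero_le_one
          · rw [Pi.single_eq_of_ne hj]) h3.le i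
        rw [Pi.single_eq_same] at h4
        exact one_ne_zero h4
      · intro z
        refine F.le_avg fun j => ?_
        by_cases hj : F.map j z = F.map i y
        · rw [hj, Pi.single_eq_same]; exact zero_le_one
        · rw [Pi.single_eq_of_ne hj]; exact le_rfl
      · exact integrable_of_abs_le (F.abs_avg_le (abs_single_le _))
    rw [ae_iff_of_countable]
    intro y hy
    by_contra hyC
    obtain ⟨z, hz, hyz⟩ := hr y
    have : ∀ z, F.Reach y z → π {z} ≠ 0 ∧ z ∉ C := by
      intro z hyz
      induction hyz with
      | refl => exact ⟨hy, hyC⟩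
      | tail _ hbc ih =>
        obtain ⟨i, rfl⟩ := hbc
        exact ⟨hatom _ ih.1 i, hout _ ih.1 ih.2 i⟩
    exact (this z hyz).2 hz
  · intro y
    rw [Pi.zero_apply, sub_nonneg]
    by_cases hy : y ∈ C
    · rw [Set.indicator_of_mem hy]
      exact F.le_avg fun i => by rw [Set.indicator_of_mem (hC y hy i)]; rfl
    · rw [Set.indicator_of_notMem hy]
      exact F.le_avg fun i => Set.indicator_nonneg (fun _ _ => zero_le_one) _
  · exact (integrable_of_abs_le (F.abs_avg_le hB)).sub (integrable_of_abs_le hB)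

/-- If any two orbits can be steered to a common point, the stationary probability measure is
unique. -/
theorem DIFS.Attracts.existsUnique_isStationary [Nonempty S] {F : DIFS S N} {K : Set S}
    (hK : F.Attracts K) (hmeet : ∀ x y, ∃ z, F.Reach x z ∧ F.Reach y z) :
    ∃! π : Measure S, IsStationary F.step π := by
  classical
  obtain ⟨c, -, hc⟩ := hK.exists_essential (Classical.arbitrary S)
  have hC := hc.isFiniteClass hK (hc.mem hK)
  obtain ⟨π, hπ, -, hpois⟩ := hC.exists_isStationary
  refine ⟨π, hπ, fun π' hπ' => ?_⟩
  have := hπ.1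
  have := hπ'.1
  have hmem := F.ae_mem_of_isStationary hC.map_mem (fun x => by
    obtain ⟨z, hxz, hcz⟩ := hmeet x c
    exact ⟨z, hcz, hxz⟩) hπ'
  refine eq_of_integral_single_eq fun y => ?_
  obtain ⟨g, hg0, hg⟩ := hpois (Pi.single y 1)
  obtain ⟨B, -, hB⟩ := exists_abs_le_of_finite hC.finite hg0
  -- The Poisson equation for `π` integrated against `π'`: stationarity of `π'` annihilates the
  -- right side.
  have h1 : ∫ z, ((Pi.single y 1 : S → ℝ) z - ∫ u, (Pi.single y 1 : S → ℝ) u ∂π) ∂π' =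
      ∫ z, (g z - F.avg g z) ∂π' := by
    refine integral_congr_ae ?_
    filter_upwards [hmem] with z hz using hg z hz
  rw [integral_sub (integrable_of_abs_le hB) (integrable_of_abs_le (F.abs_avg_le hB)),
    (F.invariant_iff π').1 hπ'.2 g B hB, sub_self, integral_sub
    (integrable_of_abs_le (abs_single_le y)) (integrable_const _), integral_const, probReal_univ,
    one_smul, sub_eq_zero] at h1
  exact h1

/-! ### Recurrent classes -/

variable {F} {K : Set S}

theorem DIFS.IsFiniteClass.mem_positiveRecurrentClasses {C : Set S} (hC : F.IsFiniteClass C) :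
    C ∈ positiveRecurrentClasses F.step := by
  refine ⟨⟨fun y hy z hz => ⟨(F.accessible_iff y z).2 (hC.reach y hy z hz),
    (F.accessible_iff z y).2 (hC.reach z hz y hy)⟩, fun B hB hCB y hy => ?_⟩,
    fun y hy z hz => F.mem_of_reach hC.map_mem hy ((F.accessible_iff y z).1 hz),
    fun y hy => hC.isPositiveRecurrent hy⟩
  obtain ⟨z, hz⟩ := hC.nonempty
  exact F.mem_of_reach hC.map_mem hz ((F.accessible_iff z y).1 (hB z (hCB hz) y hy).1)

omit [Countable S] [MeasurableSingletonClass S] in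
theorem positiveRecurrentClasses_subset (κ : Kernel S S) [IsMarkovKernel κ] :
    positiveRecurrentClasses κ ⊆ recurrentClasses κ :=
  fun _ h => ⟨h.1, h.2.1, fun y hy => (h.2.2 y hy).1⟩

theorem DIFS.Attracts.isFiniteClass [Nonempty S] (hK : F.Attracts K) {C : Set S}
    (hC : C ∈ recurrentClasses F.step) : F.IsFiniteClass C where
  nonempty := by
    by_contra h
    rw [Set.not_nonempty_iff_eq_empty] at h
    obtain ⟨y⟩ := ‹Nonempty S›
    have hyy : Communicate F.step y y :=
      ⟨(F.accessible_iff y y).2 .refl, (F.accessible_iff y y).2 .refl⟩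
    -- The empty set is not a maximal communicating set, since any singleton contains it and
    -- communicates with itself.
    have := hC.1.2 (y := {y}) (fun a ha b hb => by
      rw [Set.mem_singleton_iff.1 ha, Set.mem_singleton_iff.1 hb]
      exact hyy) (by rw [h]; exact Set.empty_subset _) (Set.mem_singleton y)
    rw [h] at this
    exact this
  finite := hK.finite.subset fun y hy => (DIFS.essential_of_isRecurrent (hC.2.2 y hy)).mem hK
  map_mem y hy i := hC.2.1 y hy _ ((F.accessible_iff y _).2 (.single ⟨i, rfl⟩))
  reach y hy z hz := (F.accessible_iff y z).1 (hC.1.1 y hy z hz).1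

theorem DIFS.Attracts.isRecurrent_iff (hK : F.Attracts K) {x : S} :
    IsRecurrent F.step x ↔ F.Essential x :=
  ⟨DIFS.essential_of_isRecurrent, fun h =>
    ((h.isFiniteClass hK (h.mem hK)).isPositiveRecurrent Relation.ReflTransGen.refl).1⟩

/-- Almost every orbit fills a class and renders a stationary measure supported by it. -/
theorem DIFS.Attracts.ae_renders (hK : F.Attracts K) (x : S) : ∀ᵐ X ∂chainLaw F.step x,
    ∃ C ∈ positiveRecurrentClasses F.step, (∃ m : ℕ, X '' Set.Ici m = C) ∧
      ∃ π : Measure S, IsStationary F.step π ∧ atoms π = C ∧ Renders X π := by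
  classical
  filter_upwards [hK.ae_exists_essential x, F.ae_edge x, F.ae_tendsto_martingale_div x]
    with X ⟨m, hm⟩ hX hM
  have hC := hm.isFiniteClass hK (hm.mem hK)
  obtain ⟨π, hπ, hatoms, hpois⟩ := hC.exists_isStationary
  have hprob := hπ.1
  have hXC := F.mem_of_orbit hC.map_mem hX (m := m) Relation.ReflTransGen.refl
  have hav : ∀ f : S → ℝ, Filter.Tendsto
      (fun M : ℕ => (1 / (M : ℝ)) * ∑ i ∈ Finset.range M, f (X i))
      Filter.atTop (nhds (∫ y, f y ∂π)) := by
    intro f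
    obtain ⟨g, hg0, hg⟩ := hpois f
    obtain ⟨B, -, hB⟩ := exists_abs_le_of_finite hC.finite hg0
    exact F.tendsto_average hB (hM _ g hC.finite hg0) fun i hi => hg _ (hXC i hi)
  have hav1 : ∀ y, Filter.Tendsto (fun M : ℕ => (1 / (M : ℝ)) *
      ∑ i ∈ Finset.range M, Set.indicator {y} (fun _ => (1 : ℝ)) (X i))
      Filter.atTop (nhds (π.real {y})) := by
    intro y
    rw [← integral_indicator_one (measurableSet_singleton y)]
    exact hav _
  refine ⟨_, hC.mem_positiveRecurrentClasses, ⟨m, ?_⟩, π, hπ, hatoms, hav1, fun f _ => hav f⟩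
  refine Set.Subset.antisymm ?_ fun y hy => ?_
  · rintro _ ⟨i, hi, rfl⟩
    exact hXC i hi
  · by_contra hne
    -- A state of the class missed from time `m` on would have frequency 0, although its frequency
    -- tends to its positive stationary mass.
    have h0 := F.tendsto_average (f := Set.indicator {y} fun _ => (1 : ℝ)) (g := 0) (a := 0)
      (B := 0) (X := X) (m := m) (by simp) (by simp [DIFS.martingale]) fun i hi => by
        have : X i ≠ y := fun h => hne ⟨i, hi, h⟩
        simp [this]
    have h1 := tendsto_nhds_unique h0 (hav1 y)
    rw [← hatoms] at hy
    exact (pos_iff_ne_zero.1 (show 0 < π {y} from hy)) ((measureReal_eq_zero_iff).1 h1.symm)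

theorem DIFS.Attracts.finite_recurrentStates (hK : F.Attracts K) :
    (recurrentStates F.step).Finite :=
  hK.finite.subset fun _ hy => (hK.isRecurrent_iff.1 hy).mem hK

theorem DIFS.Attracts.recurrentStates_nonempty [Nonempty S] (hK : F.Attracts K) :
    (recurrentStates F.step).Nonempty := by
  obtain ⟨c, -, hc⟩ := hK.exists_essential (Classical.arbitrary S)
  exact ⟨c, hK.isRecurrent_iff.2 hc⟩

theorem DIFS.Attracts.exists_class (hK : F.Attracts K) {x : S} (hx : IsRecurrent F.step x) :
    ∃ C ∈ positiveRecurrentClasses F.step, x ∈ C := by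
  have hx' := hK.isRecurrent_iff.1 hx
  exact ⟨_, (hx'.isFiniteClass hK (hx'.mem hK)).mem_positiveRecurrentClasses,
    Relation.ReflTransGen.refl⟩

theorem DIFS.Attracts.recurrentStates_eq (hK : F.Attracts K) :
    recurrentStates F.step = ⋃₀ positiveRecurrentClasses F.step := by
  ext x
  constructor
  · exact fun hx => hK.exists_class hx
  · rintro ⟨C, hC, hx⟩
    exact (hC.2.2 x hx).1

theorem DIFS.Attracts.recurrentClasses_eq [Nonempty S] (hK : F.Attracts K) :
    recurrentClasses F.step = positiveRecurrentClasses F.step :=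
  Set.Subset.antisymm (fun _ hC => (hK.isFiniteClass hC).mem_positiveRecurrentClasses)
    (positiveRecurrentClasses_subset _)

theorem DIFS.Attracts.exists_isStationary [Nonempty S] (hK : F.Attracts K) {G : Set (Set S)}
    (hG : G ⊆ positiveRecurrentClasses F.step) (hne : G.Nonempty) :
    ∃ π : Measure S, IsStationary F.step π ∧ atoms π = ⋃₀ G := by
  have hcl : ∀ C ∈ G, F.IsFiniteClass C := fun C hC =>
    hK.isFiniteClass (positiveRecurrentClasses_subset _ (hG hC))
  refine F.exists_isStationary_atoms_eq_sUnion (hK.finite.finite_subsets.subset fun C hC y hy =>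
    (DIFS.Essential.of_mem_class (hcl C hC) hy).mem hK) hne fun C hC => ?_
  obtain ⟨π, h1, h2, -⟩ := (hcl C hC).exists_isStationary
  exact ⟨π, h1, h2⟩

end Chain

/-! ### Minimal absorbing sets -/

section Absorbing

variable {S : Type*}

theorem mem_minAbsorbing_of_periodic {f : S → S} {z : S} {p : ℕ} (hp : 0 < p)
    (hz : f^[p] z = z) : z ∈ minAbsorbing f Set.univ := by
  rintro L ⟨-, hL⟩
  obtain ⟨k, hk⟩ := hL z trivial
  have h1 : f^[k * p] z = z := by
    rw [mul_comm, Function.iterate_mul]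
    exact Function.iterate_fixed hz k
  rw [← h1]
  exact hk _ (Nat.le_mul_of_pos_right k hp)

/-- From time `a` on the iterates are periodic with period `b - a`, and a periodic point lies in
every absorbing set because it recurs at arbitrarily late times. -/
theorem isAbsorbing_minAbsorbing {f : S → S}
    (h : ∀ x, ∃ a b, a < b ∧ f^[a] x = f^[b] x) :
    IsAbsorbing f Set.univ (minAbsorbing f Set.univ) := by
  refine ⟨Set.subset_univ _, fun x _ => ?_⟩
  obtain ⟨a, b, hab, hfab⟩ := h x
  refine ⟨a, fun i hi => mem_minAbsorbing_of_periodic (p := b - a) (Nat.sub_pos_of_lt hab) ?_⟩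
  rw [← Function.iterate_add_apply, show b - a + i = (i - a) + b by omega,
    Function.iterate_add_apply, ← hfab, ← Function.iterate_add_apply, Nat.sub_add_cancel hi]

theorem exists_iterate_eq {f : S → S} {K : Set S} (hK : K.Finite) (hf : ∀ x ∈ K, f x ∈ K)
    {x : S} {m : ℕ} (hm : f^[m] x ∈ K) : ∃ a b, a < b ∧ f^[a] x = f^[b] x := by
  have hmem : ∀ i, f^[i + m] x ∈ K := by
    intro i
    induction i with
    | zero => simpa using hm
    | succ i ih =>
      rw [Nat.succ_add, Function.iterate_succ_apply']
      exact hf _ ih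
  obtain ⟨a, -, b, -, hne, hab⟩ := Set.infinite_univ.exists_ne_map_eq_of_mapsTo
    (f := fun i => f^[i + m] x) (fun i _ => hmem i) hK
  rcases lt_or_gt_of_ne hne with h | h
  · exact ⟨a + m, b + m, by omega, hab⟩
  · exact ⟨b + m, a + m, by omega, hab.symm⟩

end Absorbing

/-! ### Steering orbits together, and drift towards a finite set. -/

section Meet

variable {S : Type*} {N : ℕ} {F : DIFS S N} {K : Set S}

theorem DIFS.reach_iterate (F : DIFS S N) (i : Fin N) (k : ℕ) (x : S) :
    F.Reach x ((F.map i)^[k] x) := by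
  induction k with
  | zero => exact .refl
  | succ k ih =>
    rw [Function.iterate_succ_apply']
    exact ih.tail ⟨i, rfl⟩

theorem DIFS.Attracts.isAbsorbing_minAbsorbing (hK : F.Attracts K) (i : Fin N) :
    IsAbsorbing (F.map i) Set.univ (minAbsorbing (F.map i) Set.univ) := by
  refine DiscreteIFS.isAbsorbing_minAbsorbing fun x => ?_
  obtain ⟨m, hm⟩ := hK.exists_mem (fun k => (F.map i)^[k] x) fun k =>
    ⟨i, (Function.iterate_succ_apply' _ _ _).symm⟩
  exact exists_iterate_eq hK.finite (fun x hx => hK.map_mem x hx i) hm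

theorem exists_common_of_orbitsMeet {f : S → S} {b y z : S} (hy : OrbitsMeet f b y)
    (hz : OrbitsMeet f b z) : ∃ j k, f^[j] y = f^[k] z := by
  obtain ⟨a, a', ha⟩ := hy
  obtain ⟨c, c', hc⟩ := hz
  refine ⟨c + a', a + c', ?_⟩
  rw [Function.iterate_add_apply, ← ha, Function.iterate_add_apply, ← hc,
    ← Function.iterate_add_apply, ← Function.iterate_add_apply, add_comm]

/-- Iterating `F.map i` brings both points into its minimal absorbing set. In the first case they
are then in one component, so their orbits meet; in the second, iterating `F.map j` brings both into
`B`, where they meet. -/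
theorem DIFS.Attracts.exists_reach_common (hK : F.Attracts K)
    (h : (∃ i, ∃ B, components (F.map i) Set.univ = {B}) ∨
      (∃ i j, ∃ B ∈ components (F.map j) Set.univ,
        minAbsorbing (F.map i) Set.univ ⊆ basin (F.map j) Set.univ B)) (x y : S) :
    ∃ z, F.Reach x z ∧ F.Reach y z := by
  have habs : ∀ i x, ∃ k, (F.map i)^[k] x ∈ minAbsorbing (F.map i) Set.univ := fun i x => by
    obtain ⟨k, hk⟩ := (hK.isAbsorbing_minAbsorbing i).2 x trivial
    exact ⟨k, hk k le_rfl⟩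
  rcases h with ⟨i, B, hB⟩ | ⟨i, j, B, ⟨b, hb, rfl⟩, hsub⟩
  · have hcomp : ∀ u ∈ minAbsorbing (F.map i) Set.univ,
        {v ∈ minAbsorbing (F.map i) Set.univ | OrbitsMeet (F.map i) u v} = B := fun u hu => by
      rw [← Set.mem_singleton_iff, ← hB]
      exact ⟨u, hu, rfl⟩
    obtain ⟨k, hk⟩ := habs i x
    obtain ⟨l, hl⟩ := habs i y
    have h1 : (F.map i)^[l] y ∈ {v ∈ minAbsorbing (F.map i) Set.univ |
        OrbitsMeet (F.map i) ((F.map i)^[k] x) v} := by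
      rw [hcomp _ hk, ← hcomp _ hl]
      exact ⟨hl, 0, 0, rfl⟩
    obtain ⟨-, a, c, hac⟩ := h1
    exact ⟨(F.map i)^[a] ((F.map i)^[k] x),
      (F.reach_iterate i k x).trans (F.reach_iterate i a _), by
        rw [hac]
        exact (F.reach_iterate i l y).trans (F.reach_iterate i c _)⟩
  · obtain ⟨k, hk⟩ := habs i x
    obtain ⟨l, hl⟩ := habs i y
    obtain ⟨-, k', -, hk'⟩ := hsub hk
    obtain ⟨-, l', -, hl'⟩ := hsub hl
    obtain ⟨a, c, hac⟩ := exists_common_of_orbitsMeet hk' hl'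
    exact ⟨(F.map j)^[a] ((F.map j)^[k'] ((F.map i)^[k] x)),
      ((F.reach_iterate i k x).trans (F.reach_iterate j k' _)).trans (F.reach_iterate j a _), by
        rw [hac]
        exact ((F.reach_iterate i l y).trans (F.reach_iterate j l' _)).trans
          (F.reach_iterate j c _)⟩

/-- A Lyapunov function with finite sublevel sets yields an attracting finite set. -/
theorem DIFS.attracts_of_lyapunov (F : DIFS S N) {V : S → ℝ} {c D : ℝ} (hV : ∀ x, 0 ≤ V x)
    (hc : 0 ≤ c) (hc1 : c < 1) (hfin : ∀ R, {x | V x ≤ R}.Finite)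
    (hdrift : ∀ i x, V (F.map i x) ≤ c * V x + D) :
    F.Attracts {x | V x ≤ (D + 1) / (1 - c)} := by
  have h1c : 0 < 1 - c := sub_pos.2 hc1
  -- The radius solves cR + D = R - 1: the sublevel set is invariant, and each step from outside
  -- lowers `V` by more than 1.
  have hR : (1 - c) * ((D + 1) / (1 - c)) = D + 1 := mul_div_cancel₀ _ h1c.ne'
  refine ⟨hfin _, fun x hx i => ?_, fun X hX => ?_⟩
  · change V (F.map i x) ≤ _
    have h1 := mul_le_mul_of_nonneg_left (show V x ≤ (D + 1) / (1 - c) from hx) hc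
    have h2 := hdrift i x
    linarith
  · by_contra! hne
    replace hne : ∀ k, (D + 1) / (1 - c) < V (X k) := fun k => not_le.1 (hne k)
    have hdec : ∀ k : ℕ, V (X k) ≤ V (X 0) - k := by
      intro k
      induction k with
      | zero => simp
      | succ k ih =>
        obtain ⟨i, hi⟩ := hX k
        have h1 := hdrift i (X k)
        rw [hi] at h1
        have h2 := mul_lt_mul_of_pos_left (hne k) h1c
        push_cast
        linarith
    obtain ⟨k, hk⟩ := exists_nat_gt (V (X 0))
    have h1 := hdec k
    have h2 := hV (X k)
    linarith

end Meet

/-! ### Roundoffs of contractions -/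

section Roundoff

variable {n : ℕ} (nrm : Seminorm ℝ (Fin n → ℝ))

theorem seminorm_le_mul_norm : ∃ A, 0 ≤ A ∧ ∀ y, nrm y ≤ A * ‖y‖ := by
  classical
  refine ⟨∑ j, nrm (Pi.single j 1), Finset.sum_nonneg fun _ _ => apply_nonneg _ _, fun y => ?_⟩
  have hy : y = ∑ j, y j • (Pi.single j (1 : ℝ) : Fin n → ℝ) := pi_eq_sum_univ' y
  calc nrm y = nrm (∑ j, y j • (Pi.single j (1 : ℝ) : Fin n → ℝ)) := by rw [← hy]
    _ ≤ ∑ j, nrm (y j • (Pi.single j (1 : ℝ) : Fin n → ℝ)) :=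
        Finset.le_sum_of_subadditive nrm (map_zero nrm).le (map_add_le_add nrm) _ _
    _ ≤ ∑ j, nrm (Pi.single j 1) * ‖y‖ := by
        refine Finset.sum_le_sum fun j _ => ?_
        rw [map_smul_eq_mul, mul_comm]
        exact mul_le_mul_of_nonneg_left (norm_le_pi_norm y j) (apply_nonneg _ _)
    _ = _ := (Finset.sum_mul _ _ _).symm

theorem mul_norm_le_seminorm (hnrm : ∀ x, nrm x = 0 → x = 0) :
    ∃ a, 0 < a ∧ ∀ y, a * ‖y‖ ≤ nrm y := by
  obtain ⟨A, -, hA⟩ := seminorm_le_mul_norm nrm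
  have hcont : Continuous nrm := (LipschitzWith.of_dist_le' (K := A) fun x y => by
    rw [Real.dist_eq, dist_eq_norm]
    exact (abs_sub_map_le_sub nrm x y).trans (hA _)).continuous
  by_cases hne : (Metric.sphere (0 : Fin n → ℝ) 1).Nonempty
  · obtain ⟨u, hu, hmin⟩ := (isCompact_sphere (0 : Fin n → ℝ) 1).exists_isMinOn hne
      hcont.continuousOn
    have hu1 : ‖u‖ = 1 := by simpa using hu
    refine ⟨nrm u, lt_of_le_of_ne (apply_nonneg _ _) fun h => ?_, fun y => ?_⟩
    · rw [hnrm u h.symm, norm_zero] at hu1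
      exact zero_ne_one hu1
    · by_cases hy : y = 0
      · simp [hy]
      · have hy' : 0 < ‖y‖ := norm_pos_iff.2 hy
        have h1 : nrm u ≤ nrm (‖y‖⁻¹ • y) := hmin (by simp [norm_smul, hy'.ne'])
        rw [map_smul_eq_mul, norm_inv, norm_norm, inv_mul_eq_div] at h1
        exact (le_div_iff₀ hy').1 h1
  -- The sphere is empty when `n = 0`; the only vector is then 0.
  · refine ⟨1, one_pos, fun y => ?_⟩
    by_cases hy : y = 0
    · simp [hy]
    · exact absurd ⟨‖y‖⁻¹ • y, by simp [norm_smul, hy]⟩ hne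

theorem finite_grid_sublevel {δ : ℝ} (hδ : 0 < δ) (hnrm : ∀ x, nrm x = 0 → x = 0) (R : ℝ) :
    {x : grid n δ | nrm x ≤ R}.Finite := by
  obtain ⟨a, ha, hle⟩ := mul_norm_le_seminorm nrm hnrm
  let b : Fin n → ℤ := fun _ => ⌈R / a / δ⌉
  refine ((Set.finite_Icc (-b) b).image fun m =>
    (⟨fun j => δ * (m j : ℝ), m, rfl⟩ : grid n δ)).subset ?_
  rintro ⟨_, m, rfl⟩ hx
  refine ⟨m, ?_, rfl⟩
  have hj : ∀ j, |(m j : ℝ)| ≤ R / a / δ := by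
    intro j
    rw [le_div_iff₀ hδ, le_div_iff₀ ha]
    have h1 := norm_le_pi_norm (fun j => δ * (m j : ℝ)) j
    rw [Real.norm_eq_abs, abs_mul, abs_of_pos hδ] at h1
    have h2 := mul_le_mul_of_nonneg_left h1 ha.le
    have h3 := (h2.trans (hle _)).trans (show nrm _ ≤ R from hx)
    linarith
  constructor
  · intro j
    have h1 := (abs_le.1 (hj j)).1
    have h2 := Int.le_ceil (R / a / δ)
    have : ((-b j : ℤ) : ℝ) ≤ m j := by
      simp only [b]
      push_cast
      linarith
    exact_mod_cast this
  · intro j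
    have h1 := (abs_le.1 (hj j)).2
    have h2 := Int.le_ceil (R / a / δ)
    have : (m j : ℝ) ≤ (b j : ℤ) := by
      simp only [b]
      linarith
    exact_mod_cast this

theorem norm_roundoff_sub_le {δ : ℝ} (hδ : 0 < δ) (x : Fin n → ℝ) :
    ‖(roundoff δ x : Fin n → ℝ) - x‖ ≤ δ := by
  rw [pi_norm_le_iff_of_nonneg hδ.le]
  intro j
  have h := (mem_cube_iff hδ x (cubeIndex δ x)).2 rfl j
  rw [Real.norm_eq_abs, abs_le]
  change -δ ≤ δ * (cubeIndex δ x j : ℝ) - x j ∧ δ * (cubeIndex δ x j : ℝ) - x j ≤ δ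
  constructor <;> nlinarith [h.1, h.2]

/-- The seminorm is the Lyapunov function: contraction gives the factor, and the rounding error
together with the image of 0 gives the additive constant, with maxima taken over the finitely many
maps. -/
theorem exists_attracts {N : ℕ} {δ : ℝ} (hδ : 0 < δ) (hnrm : ∀ x, nrm x = 0 → x = 0)
    {w : Fin N → (Fin n → ℝ) → (Fin n → ℝ)} (hw : ∀ i, IsContraction nrm (w i))
    (F : DIFS (grid n δ) N) (hF : ∀ i, F.map i = roundoffMap δ (w i)) :
    ∃ K, F.Attracts K := by
  have := F.nonempty_index (roundoff δ 0)
  obtain ⟨A, hA0, hA⟩ := seminorm_le_mul_norm nrm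
  choose c hc0 hc1 hc using hw
  obtain ⟨i₀, hi₀⟩ := Finite.exists_max c
  obtain ⟨i₁, hi₁⟩ := Finite.exists_max fun i => nrm (w i 0)
  refine ⟨_, F.attracts_of_lyapunov (V := fun x => nrm x) (c := c i₀)
    (D := A * δ + nrm (w i₁ 0)) (fun _ => apply_nonneg _ _) (hc0 i₀) (hc1 i₀)
    (finite_grid_sublevel nrm hδ hnrm) fun i x => ?_⟩
  rw [hF i]
  have h1 : nrm ((roundoff δ (w i x) : Fin n → ℝ) - w i x) ≤ A * δ :=
    (hA _).trans (mul_le_mul_of_nonneg_left (norm_roundoff_sub_le hδ _) hA0)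
  have h2 : nrm (w i x - w i 0) ≤ c i₀ * nrm x := by
    refine (hc i x 0).trans ?_
    rw [sub_zero]
    exact mul_le_mul_of_nonneg_right (hi₀ i) (apply_nonneg _ _)
  calc nrm (roundoffMap δ (w i) x : Fin n → ℝ)
      = nrm (((roundoff δ (w i x) : Fin n → ℝ) - w i x) + (w i x - w i 0) + w i 0) := by
        congr 1
        simp [roundoffMap]
    _ ≤ nrm ((roundoff δ (w i x) : Fin n → ℝ) - w i x) + nrm (w i x - w i 0) + nrm (w i 0) :=
        (map_add_le_add nrm _ _).trans (add_le_add_left (map_add_le_add nrm _ _) _)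
    _ ≤ _ := by linarith [hi₁ i]

end Roundoff

end DiscreteIFS

theorem mainTheorem11 {n N : ℕ} {δ : ℝ} (hδ : 0 < δ)
    (nrm : Seminorm ℝ (Fin n → ℝ)) (hnrm : ∀ x, nrm x = 0 → x = 0)
    (w : Fin N → (Fin n → ℝ) → (Fin n → ℝ))
    (hw : ∀ i, DiscreteIFS.IsContraction nrm (w i))
    (F : DiscreteIFS.DIFS (DiscreteIFS.grid n δ) N)
    (hF : ∀ i, F.map i = DiscreteIFS.roundoffMap δ (w i)) :
    -- the set of recurrent states is nonempty and finite, and its states are positive recurrent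
    (DiscreteIFS.recurrentStates F.step).Nonempty ∧
    (DiscreteIFS.recurrentStates F.step).Finite ∧
    (∀ x ∈ DiscreteIFS.recurrentStates F.step, DiscreteIFS.IsPositiveRecurrent F.step x) ∧
    -- it is composed of the recurrent classes, and these are the positive recurrent ones
    DiscreteIFS.recurrentClasses F.step = DiscreteIFS.positiveRecurrentClasses F.step ∧
    (DiscreteIFS.positiveRecurrentClasses F.step).Nonempty ∧
    DiscreteIFS.recurrentStates F.step = ⋃₀ DiscreteIFS.positiveRecurrentClasses F.step ∧
    -- stationary probability measures supported by unions of classes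
    (∀ G ⊆ DiscreteIFS.positiveRecurrentClasses F.step, G.Nonempty →
      ∃ π : MeasureTheory.Measure (DiscreteIFS.grid n δ),
        DiscreteIFS.IsStationary F.step π ∧ DiscreteIFS.atoms π = ⋃₀ G) ∧
    -- escape from the transient states
    (∀ x, DiscreteIFS.chainLaw F.step x
      {X | ∃ i : ℕ, X i ∉ DiscreteIFS.transientStates F.step} = 1) ∧
    -- almost every orbit fills one class and renders a stationary measure supported by it
    (∀ x, ∀ᵐ X ∂(DiscreteIFS.chainLaw F.step x),
      ∃ C ∈ DiscreteIFS.positiveRecurrentClasses F.step,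
        (∃ m : ℕ, X '' Set.Ici m = C) ∧
        ∃ π : MeasureTheory.Measure (DiscreteIFS.grid n δ),
          DiscreteIFS.IsStationary F.step π ∧ DiscreteIFS.atoms π = C ∧
          DiscreteIFS.Renders X π) ∧
    -- each map has a minimal absorbing set
    (∀ i, DiscreteIFS.IsAbsorbing (F.map i) Set.univ
      (DiscreteIFS.minAbsorbing (F.map i) Set.univ)) ∧
    -- uniqueness of the stationary probability measure
    (((∃ i, ∃ B, DiscreteIFS.components (F.map i) Set.univ = {B}) ∨
      (∃ i j, ∃ B ∈ DiscreteIFS.components (F.map j) Set.univ,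
        DiscreteIFS.minAbsorbing (F.map i) Set.univ ⊆
          DiscreteIFS.basin (F.map j) Set.univ B)) →
      ∃! π : MeasureTheory.Measure (DiscreteIFS.grid n δ),
        DiscreteIFS.IsStationary F.step π) := by
  have hne : Nonempty (DiscreteIFS.grid n δ) := ⟨DiscreteIFS.roundoff δ 0⟩
  obtain ⟨K, hK⟩ := DiscreteIFS.exists_attracts nrm hδ hnrm hw F hF
  obtain ⟨a, ha⟩ := hK.recurrentStates_nonempty
  obtain ⟨C, hC, -⟩ := hK.exists_class ha
  refine ⟨⟨a, ha⟩, hK.finite_recurrentStates, fun x hx => ?_, hK.recurrentClasses_eq, ⟨C, hC⟩,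
    hK.recurrentStates_eq, fun G hG hGne => hK.exists_isStationary hG hGne, fun x => ?_,
    hK.ae_renders, hK.isAbsorbing_minAbsorbing,
    fun h => hK.existsUnique_isStationary (hK.exists_reach_common h)⟩
  · obtain ⟨B, hB, hxB⟩ := hK.exists_class hx
    exact hB.2.2 x hxB
  · refine (measure_congr (Filter.eventuallyEq_univ.2 ?_)).trans measure_univ
    filter_upwards [hK.ae_exists_essential x] with X ⟨k, hk⟩
    exact ⟨k, fun h => h (hK.isRecurrent_iff.2 hk)⟩
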